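/- Call $g:(0,\infty)\to\mathbb R$ completely monotone if $g\in C^\infty(0,\infty)$ and $(-1)^n g^{(n)}(r)\ge 0$ for all $r>0$, $n\ge 0$. A continuous function $\psi:\mathbb R^k\to\mathbb C$ with $\psi(0)=0$ is called continuous negative definite if all matrices $\bigl(\psi(\xi_i)+\overline{\psi(\xi_j)}-\psi(\xi_i-\xi_j)\bigr)_{i,j\le n}$, $n\in\mathbb N$, $\xi_1,\dots,\xi_n\in\mathbb R^k$, are Hermitian and positive semidefinite. A $k$-dimensional Lévy process $(X_t)_{t\ge0}$ has characteristic exponent $\psi$ if $\mathbb E e^{i\xi\cdot X_t}=e^{-t\psi(\xi)}$; its Lévy measure is the measure $\nu$ in the Lévy–Khintchine representation $$\psi(\xi)=-ib\cdot\xi+\tfrac12\,\xi\cdot Q\xi+\int_{\mathbb R^k\setminus\{0\}}\bigl(1-e^{iy\cdot\xi}+iy\cdot\xi\,\mathbf 1_{(0,1)}(|y|)\bigr)\,\nu(dy).$$ Let $f:[0,\infty)\to[0,\infty)$ and suppose that at least one of the following (equivalent) conditions holds: (a) $\mathbb R^k\ni\xi\mapsto f(|\xi|^2)$ is continuous negative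 definite for every $k\ge1$; (b) $\mathbb R^k\ni\xi\mapsto f(|\xi|^2)$ is continuous negative definite for every $k=1+2n$, $n\ge0$; (c) $f$ is a Bernstein function, i.e. $f(u)=\alpha u+\int_{(0,\infty)}(1-e^{-uy})\,\mu(dy)$ for all $u\ge0$, with $\alpha\ge0$ and $\int_{(0,\infty)}\min\{1,y\}\,\mu(dy)<\infty$; (d) for some $k\ge1$ there is a $k$-dimensional Lévy process $(X_t)_{t\ge0}$ with characteristic exponent $f(|\xi|^2)$ such that $\mathbb P(X_t\in dx)=e^{-ct}\delta_0(dx)+p_t(|x|)\,dx$ for all $t>0$, for some $c\in[0,\infty]$ (with $e^{-\infty}=0$) and functions $p_t:[0,\infty)\to[0,\infty)$ for which $r\mapsto p_t(\sqrt r)$ is completely monotone. Then there are $c\in[0,\infty]$ and functions $p_t^k,m_k:[0,\infty)\to[0,\infty)$, $k\ge1$, $t>0$, such that $r\mapsto p_t^k(\sqrt r)$ and $r\mapsto m_k(\sqrt r)$ are completely monotone and, for every $k\ge1$ and every $k$-dimensional Lévy process $(X_t)_{t\ge0}$ with characteristic exponent $f(|\xi|^2)$, $$\mathbb P(X_t\in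 dx)=e^{-ct}\delta_0(dx)+p_t^k(|x|)\,dx\quad(t>0),$$ and the Lévy measure $\nu_k$ of $(X_t)_{t\ge0}$ exists, is unique and equals $\nu_k(dx)=m_k(|x|)\,dx$. Moreover, for all $k\ge3$: (i) $p_t^k$ and $p_t^{k-2}$ satisfy, for all $t>0$ and $r>0$ (with $p_t^{k-2}$ differentiable at $r$), $$p_t^k(r)=-\frac1{2\pi r}\,\frac{d}{dr}\,p_t^{k-2}(r);$$ (ii) $m_k$ and $m_{k-2}$ satisfy, for all $r>0$ (with $m_{k-2}$ differentiable at $r$), $$m_k(r)=-\frac1{2\pi r}\,\frac{d}{dr}\,m_{k-2}(r).$$ -/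

import Mathlib

open MeasureTheory ProbabilityTheory Filter Topology Set
open scoped NNReal ENNReal ComplexOrder

universe u v

noncomputable section

/-- `ℝᵏ` with its Euclidean norm. -/
abbrev Rk (k : ℕ) : Type := EuclideanSpace ℝ (Fin k)

/-- Completely monotone functions on `(0,∞)`: smooth there, with `(-1)ⁿ g⁽ⁿ⁾(r) ≥ 0`. -/
def IsCompletelyMonotone (g : ℝ → ℝ) : Prop :=
  ContDiffOn ℝ (⊤ : ℕ∞) g (Ioi 0) ∧ ∀ (n : ℕ) (r : ℝ), 0 < r → 0 ≤ (-1) ^ n * iteratedDeriv n g r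

/-- Bernstein functions on `[0,∞)`:
`f(u) = α u + ∫_{(0,∞)} (1 - e^{-uy}) μ(dy)` with `α ≥ 0` and `∫_{(0,∞)} min{1,y} μ(dy) < ∞`. -/
def IsBernstein (f : ℝ → ℝ) : Prop :=
  ∃ (α : ℝ) (μ : Measure ℝ), 0 ≤ α ∧ ∫⁻ y in Ioi 0, ENNReal.ofReal (min 1 y) ∂μ < ∞ ∧
    ∀ u : ℝ, 0 ≤ u → f u = α * u + ∫ y in Ioi 0, (1 - Real.exp (-(u * y))) ∂μ

/-- Continuous negative definite functions in the sense of Schoenberg, normalized by `ψ(0) = 0`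
(that is, without killing): all matrices `(ψ(ξᵢ) + conj ψ(ξⱼ) - ψ(ξᵢ - ξⱼ))ᵢⱼ` are Hermitian and
positive semidefinite. -/
def IsContinuousNegativeDefinite {k : ℕ} (ψ : Rk k → ℂ) : Prop :=
  Continuous ψ ∧ ψ 0 = 0 ∧ ∀ (n : ℕ) (ξ : Fin n → Rk k),
    (Matrix.of fun i j : Fin n => ψ (ξ i) + star (ψ (ξ j)) - ψ (ξ i - ξ j)).PosSemidef

/-- A `k`-dimensional Lévy process `(X_t)_{t ≥ 0}` on the probability space `(Ω, P)`. -/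
structure IsLevyProcess {Ω : Type*} [MeasurableSpace Ω] {k : ℕ} (P : Measure Ω)
    (X : ℝ≥0 → Ω → Rk k) : Prop where
  isProbabilityMeasure : IsProbabilityMeasure P
  measurable : ∀ t, Measurable (X t)
  start_zero : ∀ᵐ ω ∂P, X 0 ω = 0
  indep_increments : HasIndepIncrements X P
  stationary_increments : ∀ s h : ℝ≥0, P.map (fun ω => X (s + h) ω - X s ω) = P.map (X h)
  cadlag : ∀ᵐ ω ∂P, ∀ t : ℝ≥0, ContinuousWithinAt (fun s => X s ω) (Ici t) t ∧
    ∃ l, Tendsto (fun s => X s ω) (𝓝[<] t) (𝓝 l)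

/-- `ψ` is the characteristic exponent of `X`: `E e^{i ξ·X_t} = e^{-t ψ(ξ)}`. -/
def HasCharExponent {Ω : Type*} [MeasurableSpace Ω] {k : ℕ} (P : Measure Ω)
    (X : ℝ≥0 → Ω → Rk k) (ψ : Rk k → ℂ) : Prop :=
  ∀ (t : ℝ≥0) (ξ : Rk k), charFun (P.map (X t)) ξ = Complex.exp (-((t : ℂ) * ψ ξ))

/-- The Lévy–Khintchine exponent
`-i b·ξ + ½ ξ·Qξ + ∫ (1 - e^{i y·ξ} + i y·ξ 1_{(0,1)}(|y|)) ν(dy)`.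
The integrand vanishes at `y = 0`. -/
def levyKhintchineExponent {k : ℕ} (b : Rk k) (Q : Matrix (Fin k) (Fin k) ℝ)
    (ν : Measure (Rk k)) (ξ : Rk k) : ℂ :=
  -Complex.I * (inner ℝ b ξ : ℝ)
    + (1 / 2 : ℂ) * ((WithLp.ofLp ξ ⬝ᵥ Q.mulVec (WithLp.ofLp ξ) : ℝ) : ℂ)
    + ∫ y : Rk k, (1 - Complex.exp (Complex.I * (inner ℝ y ξ : ℝ))
        + (Metric.ball (0 : Rk k) 1).indicator
            (fun z => Complex.I * (inner ℝ z ξ : ℝ)) y) ∂ν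

/-- `(b, Q, ν)` is the Lévy triplet of `X`. The measure `ν` on `ℝᵏ ∖ {0}` is viewed as a measure
on `ℝᵏ` that does not charge `{0}`. -/
structure HasLevyTriplet {Ω : Type*} [MeasurableSpace Ω] {k : ℕ} (P : Measure Ω)
    (X : ℝ≥0 → Ω → Rk k) (b : Rk k) (Q : Matrix (Fin k) (Fin k) ℝ) (ν : Measure (Rk k)) :
    Prop where
  posSemidef : Q.PosSemidef
  zero : ν {0} = 0
  integrable : ∫⁻ y, ENNReal.ofReal (min 1 (‖y‖ ^ 2)) ∂ν < ∞
  exponent : HasCharExponent P X (levyKhintchineExponent b Q ν)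

/-- `ν` is the Lévy measure of `X`. -/
def IsLevyMeasureOf {Ω : Type*} [MeasurableSpace Ω] {k : ℕ} (ν : Measure (Rk k)) (P : Measure Ω)
    (X : ℝ≥0 → Ω → Rk k) : Prop :=
  ∃ (b : Rk k) (Q : Matrix (Fin k) (Fin k) ℝ), HasLevyTriplet P X b Q ν

/-- The function `ξ ↦ f(|ξ|²)` on `ℝᵏ`. -/
def radialSymbol (f : ℝ → ℝ) (k : ℕ) (ξ : Rk k) : ℂ := ((f (‖ξ‖ ^ 2) : ℝ) : ℂ)

/-- The measure `g(|x|) dx` on `ℝᵏ`, for a radial profile `g : [0,∞) → [0,∞)`. -/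
def radialMeasure (k : ℕ) (g : ℝ → ℝ) : Measure (Rk k) :=
  volume.withDensity fun x => ENNReal.ofReal (g ‖x‖)

/-- The measure `e^{-ct} δ₀(dx) + g(|x|) dx` on `ℝᵏ`, where `c ∈ [0,∞]` and `e^{-∞} = 0`. -/
def radialLaw (k : ℕ) (c : ℝ≥0∞) (t : ℝ≥0) (g : ℝ → ℝ) : Measure (Rk k) :=
  EReal.exp (-((c * t : ℝ≥0∞) : EReal)) • Measure.dirac 0 + radialMeasure k g

/-- A radial profile `g : [0,∞) → [0,∞)` such that `g(√·)` is completely monotone. -/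
def IsCMProfile (g : ℝ → ℝ) : Prop :=
  (∀ r, 0 ≤ r → 0 ≤ g r) ∧ IsCompletelyMonotone fun r => g (√r)

end

/-!
Each of the four conditions says that `f` is a Bernstein function. A Bernstein function is the
Laplace exponent of laws `η_t` on `[0,∞)`, `∫ e^{-us} η_t(ds) = e^{-tf(u)}`, and since
`e^{-s|ξ|²}` is the characteristic function of the normal law with density
`(4πs)^{-k/2} e^{-|x|²/4s}`, the process with exponent `f(|ξ|²)` has, in every dimension, the law
obtained by randomizing `s` according to `η_t`. In the same way its Lévy measure is obtained by
randomizing `s` according to the measure `μ` of the Bernstein representation of `f`. The profile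
`gaussMix k ρ` of such a mixture is a Laplace transform as a function of `r²`
(`isCMProfile_gaussMix`), and its derivative in `r` is `-2πr gaussMix (k + 2) ρ`, because the
derivative of the Gaussian function produces the factor `(4πs)⁻¹` that the dimension `k + 2`
requires (`hasDerivAt_gaussMix`). The atom of `η_t` at `0` has mass `e^{-ct}`, `c = sup f`.

To treat the four conditions alike, complete monotonicity is expressed by alternating differences
(`IsDiffCM`), a notion that is stable under products and pointwise limits. For continuous functions
it characterizes Laplace transforms of finite measures (`IsDiffCM.exists_laplace`). The proof reads
the Bernstein polynomials of `g(m ·)` at `1 - e^{-u/m}` as Laplace transforms, and uses compactness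
of the space of probability measures on `[0,1]`. Accordingly `IsDiffBernstein` asks that the
increments `f(· + a) - f` be completely monotone; it is equivalent to the integral representation
(`IsDiffBernstein.isBernstein`, `IsBernstein.isDiffBernstein`), and it implies that `e^{-tf}` is
completely monotone, as the limit of `(1 + tf/n)^{-n}`.

* If `f(|ξ|²)` is negative definite in all odd dimensions, a configuration of points may be
  completed by translates along many orthogonal directions. In the limit of infinitely many
  directions, the quadratic forms of the second differences of `-f` become nonnegative
  (`radialForm_shift_nonneg`). That the forms of first differences have a sign follows because a
  convex sequence that does not grow must decrease (`le_of_convex_seq`).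
* If the laws have completely monotone profiles, these are mixtures of Gaussian functions, whose
  Fourier transforms are completely monotone in `|ξ|²`; so are all `e^{-tf}`
  (`isDiffCM_of_charFun_radialLaw`), and thus the increments of `f = lim (1 - e^{-tf}) / t`.

Uniqueness of the Lévy measure `ν` is seen from the second differences of the exponent: they are the
characteristic functions of the finite measures `2 (1 - cos(w·y)) ν(dy)`, up to atoms at `0`
(`levyMeasure_unique`).
-/

/-! ### Alternating differences -/

/-- `g` is monotone of order `n` on `[0,∞)` in the sense of differences: every product of at most
`n` operators `g ↦ g - g(· + h)`, `h ≥ 0`, maps `g` to a function that is nonnegative on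
`[0,∞)`. No smoothness is required, so that the class is closed under pointwise limits. -/
def DiffMonotone : ℕ → (ℝ → ℝ) → Prop
  | 0, g => ∀ u, 0 ≤ u → 0 ≤ g u
  | n + 1, g => DiffMonotone n g ∧ ∀ h, 0 ≤ h → DiffMonotone n fun u => g u - g (u + h)

/-- Complete monotonicity on the closed half-line `[0,∞)`, in terms of differences. -/
def IsDiffCM (g : ℝ → ℝ) : Prop := ∀ n, DiffMonotone n g

namespace DiffMonotone

lemma nonneg {n : ℕ} {g : ℝ → ℝ} (hg : DiffMonotone n g) {u : ℝ} (hu : 0 ≤ u) : 0 ≤ g u := by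
  induction n with
  | zero => exact hg u hu
  | succ n ih => exact ih hg.1

lemma congr {n : ℕ} {g g' : ℝ → ℝ} (hg : DiffMonotone n g) (h : ∀ u, 0 ≤ u → g u = g' u) :
    DiffMonotone n g' := by
  induction n generalizing g g' with
  | zero => exact fun u hu => h u hu ▸ hg u hu
  | succ n ih =>
    exact ⟨ih hg.1 h, fun a ha => ih (hg.2 a ha) fun u hu => by
      rw [h u hu, h (u + a) (by positivity)]⟩

lemma comp_add {n : ℕ} {g : ℝ → ℝ} (hg : DiffMonotone n g) {a : ℝ} (ha : 0 ≤ a) :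
    DiffMonotone n fun u => g (u + a) := by
  induction n generalizing g with
  | zero => exact fun u hu => hg _ (by positivity)
  | succ n ih =>
    refine ⟨ih hg.1, fun h hh => (ih (hg.2 h hh)).congr fun u _ => ?_⟩
    simp only [add_right_comm]

lemma add {n : ℕ} {f g : ℝ → ℝ} (hf : DiffMonotone n f) (hg : DiffMonotone n g) :
    DiffMonotone n fun u => f u + g u := by
  induction n generalizing f g with
  | zero => exact fun u hu => add_nonneg (hf u hu) (hg u hu)
  | succ n ih =>
    exact ⟨ih hf.1 hg.1, fun h hh => (ih (hf.2 h hh) (hg.2 h hh)).congr fun u _ => by ring⟩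

lemma const_mul {n : ℕ} {g : ℝ → ℝ} (hg : DiffMonotone n g) {c : ℝ} (hc : 0 ≤ c) :
    DiffMonotone n fun u => c * g u := by
  induction n generalizing g with
  | zero => exact fun u hu => mul_nonneg hc (hg u hu)
  | succ n ih => exact ⟨ih hg.1, fun h hh => (ih (hg.2 h hh)).congr fun u _ => by ring⟩

/-- The Leibniz rule `fg - (fg)(· + h) = (f - f(· + h)) g + f(· + h) (g - g(· + h))`. -/
lemma mul {n : ℕ} {f g : ℝ → ℝ} (hf : DiffMonotone n f) (hg : DiffMonotone n g) :
    DiffMonotone n fun u => f u * g u := by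
  induction n generalizing f g with
  | zero => exact fun u hu => mul_nonneg (hf u hu) (hg u hu)
  | succ n ih =>
    exact ⟨ih hf.1 hg.1, fun h hh =>
      ((ih (hf.2 h hh) hg.1).add (ih (hf.1.comp_add hh) (hg.2 h hh))).congr fun u _ => by ring⟩

lemma of_tendsto {ι : Type*} {l : Filter ι} [l.NeBot] {n : ℕ} {F : ι → ℝ → ℝ} {g : ℝ → ℝ}
    (hF : ∀ᶠ i in l, DiffMonotone n (F i))
    (h : ∀ u, 0 ≤ u → Tendsto (fun i => F i u) l (𝓝 (g u))) : DiffMonotone n g := by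
  induction n generalizing F g with
  | zero => exact fun u hu => ge_of_tendsto (h u hu) (hF.mono fun i hi => hi u hu)
  | succ n ih =>
    exact ⟨ih (hF.mono fun i hi => hi.1) h, fun a ha =>
      ih (hF.mono fun i hi => hi.2 a ha) fun u hu => (h u hu).sub (h _ (by positivity))⟩

lemma const {c : ℝ} (hc : 0 ≤ c) (n : ℕ) : DiffMonotone n fun _ => c := by
  induction n generalizing c with
  | zero => exact fun _ _ => hc
  | succ n ih => exact ⟨ih hc, fun h hh => by simpa using ih le_rfl⟩

lemma pow {n : ℕ} {g : ℝ → ℝ} (hg : DiffMonotone n g) (m : ℕ) :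
    DiffMonotone n fun u => g u ^ m := by
  induction m with
  | zero => simpa using const zero_le_one n
  | succ m ih => simpa only [pow_succ] using ih.mul hg

lemma iterate_diff_nonneg {n : ℕ} {g : ℝ → ℝ} (hg : DiffMonotone n g) {h u : ℝ} (hh : 0 ≤ h)
    (hu : 0 ≤ u) : 0 ≤ ((fun (f : ℝ → ℝ) u => f u - f (u + h))^[n] g) u := by
  induction n generalizing g with
  | zero => exact hg u hu
  | succ n ih => exact ih (hg.2 h hh)

end DiffMonotone

namespace IsDiffCM

lemma diff {g : ℝ → ℝ} (hg : IsDiffCM g) {h : ℝ} (hh : 0 ≤ h) :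
    IsDiffCM fun u => g u - g (u + h) := fun n => (hg (n + 1)).2 h hh

lemma nonneg {g : ℝ → ℝ} (hg : IsDiffCM g) {u : ℝ} (hu : 0 ≤ u) : 0 ≤ g u := (hg 0).nonneg hu

lemma antitone {g : ℝ → ℝ} (hg : IsDiffCM g) {u v : ℝ} (hu : 0 ≤ u) (huv : u ≤ v) :
    g v ≤ g u := by
  have := (hg.diff (sub_nonneg.2 huv)).nonneg hu
  simp only [add_sub_cancel] at this
  linarith

end IsDiffCM

/-- Laplace transforms, with an arbitrary exponent `φ ≥ 0` and density `w ≥ 0`, are completely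
monotone: a difference replaces `w` by `w (1 - e^{-hφ})`. -/
lemma isDiffCM_integral {α : Type*} [MeasurableSpace α] {ρ : Measure α} {w φ : α → ℝ}
    (hw : Integrable w ρ) (hw0 : ∀ᵐ s ∂ρ, 0 ≤ w s) (hφ : Measurable φ)
    (hφ0 : ∀ᵐ s ∂ρ, 0 ≤ φ s) : IsDiffCM fun u => ∫ s, w s * Real.exp (-(u * φ s)) ∂ρ := by
  have key : ∀ v : α → ℝ, Integrable v ρ → ∀ u, 0 ≤ u →
      Integrable (fun s => v s * Real.exp (-(u * φ s))) ρ := fun v hv u hu => by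
    refine hv.mul_bdd (c := 1) (by fun_prop) (hφ0.mono fun s hs => ?_)
    rw [Real.norm_eq_abs, abs_of_pos (Real.exp_pos _), Real.exp_le_one_iff]
    nlinarith [mul_nonneg hu hs]
  intro n
  induction n generalizing w with
  | zero => exact fun u _ => integral_nonneg_of_ae (hw0.mono fun s hs => by positivity)
  | succ n ih =>
    refine ⟨ih hw hw0, fun h hh => ?_⟩
    refine (ih (w := fun s => w s - w s * Real.exp (-(h * φ s))) (hw.sub (key w hw h hh))
      ?_).congr fun u hu => ?_
    · filter_upwards [hw0, hφ0] with s hs hs'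
      have : Real.exp (-(h * φ s)) ≤ 1 := Real.exp_le_one_iff.2 (by nlinarith [mul_nonneg hh hs'])
      nlinarith
    · rw [← integral_sub (key w hw u hu) (key w hw _ (by positivity))]
      congr 1 with s
      rw [add_mul, neg_add, Real.exp_add]
      ring

lemma IsCompletelyMonotone.contDiffAt {g : ℝ → ℝ} (hg : IsCompletelyMonotone g) {r : ℝ}
    (hr : 0 < r) (n : ℕ) : ContDiffAt ℝ n g r :=
  ((hg.1.contDiffAt (Ioi_mem_nhds hr)).of_le (by exact_mod_cast le_top))

lemma IsCompletelyMonotone.diff {g : ℝ → ℝ} (hg : IsCompletelyMonotone g) {h : ℝ} (hh : 0 ≤ h) :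
    IsCompletelyMonotone fun u => g u - g (u + h) := by
  have hmaps : MapsTo (fun u : ℝ => u + h) (Ioi 0) (Ioi 0) := fun u hu => by
    simp only [mem_Ioi] at *; positivity
  refine ⟨hg.1.sub (hg.1.comp (by fun_prop) hmaps), fun n r hr => ?_⟩
  have hd : ∀ x, 0 < x → HasDerivAt (iteratedDeriv n g) (iteratedDeriv (n + 1) g x) x := by
    intro x hx
    rw [iteratedDeriv_succ]
    have h1 : DifferentiableOn ℝ (iteratedDeriv n g) (Ioi 0) :=
      (hg.1.differentiableOn_iteratedDerivWithin (m := n) (by exact_mod_cast WithTop.coe_lt_top _)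
        (uniqueDiffOn_Ioi 0)).congr fun y hy => (iteratedDerivWithin_of_isOpen isOpen_Ioi hy).symm
    exact (h1.differentiableAt (Ioi_mem_nhds hx)).hasDerivAt
  have hanti : AntitoneOn (fun x => (-1) ^ n * iteratedDeriv n g x) (Ioi 0) := by
    refine antitoneOn_of_hasDerivWithinAt_nonpos (convex_Ioi 0)
      (f' := fun x => (-1) ^ n * iteratedDeriv (n + 1) g x) ?_ ?_ ?_
    · exact fun x hx => ((hd x hx).const_mul _).continuousAt.continuousWithinAt
    · intro x hx
      rw [interior_Ioi] at hx ⊢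
      exact ((hd x hx).const_mul _).hasDerivWithinAt
    · intro x hx
      rw [interior_Ioi] at hx
      have := hg.2 (n + 1) x hx
      rw [pow_succ] at this
      linarith
  have hc2 : ContDiffAt ℝ n (fun u => g (u + h)) r :=
    (hg.contDiffAt (hmaps hr) n).comp (f := fun u : ℝ => u + h) r (by fun_prop)
  have := iteratedDeriv_fun_sub (hg.contDiffAt hr n) hc2
  rw [this, iteratedDeriv_comp_add_const]
  have := hanti (mem_Ioi.2 hr) (hmaps hr) (by simpa using hh)
  simp only at this
  linarith

lemma IsCompletelyMonotone.isDiffCM_comp_add {g : ℝ → ℝ} (hg : IsCompletelyMonotone g) {ε : ℝ}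
    (hε : 0 < ε) : IsDiffCM fun u => g (u + ε) := by
  intro n
  induction n generalizing g with
  | zero => exact fun u hu => by simpa using hg.2 0 (u + ε) (by positivity)
  | succ n ih =>
    exact ⟨ih hg, fun h hh => (ih (hg.diff hh)).congr fun u _ => by simp only [add_right_comm]⟩

/-! ### Completely monotone functions are Laplace transforms -/

/-- The binomial theorem for `z + (1 - z) E = E + z (1 - E)`, where `E` is the shift by `h`: the
Bernstein polynomial of `g(N h ·)` at `1 - z` is a polynomial in `z` whose coefficients are
differences of `g`. -/
lemma sum_shift_eq_sum_diff (g : ℝ → ℝ) (h z : ℝ) (N : ℕ) :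
    ∑ j ∈ Finset.range (N + 1), (N.choose j : ℝ) * (1 - z) ^ j * z ^ (N - j) * g (j * h) =
      ∑ k ∈ Finset.range (N + 1), z ^ k * ((N.choose k : ℝ) *
        ((fun (f : ℝ → ℝ) u => f u - f (u + h))^[k] g) ((N - k : ℕ) * h)) := by
  let S : Module.End ℝ (ℝ → ℝ) := LinearMap.funLeft ℝ ℝ (· + h)
  have hS : ∀ (k : ℕ) (f : ℝ → ℝ) (u : ℝ), (S ^ k) f u = f (u + k * h) := by
    intro k
    induction k with
    | zero => intro f u; simp
    | succ k ih =>
      intro f u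
      rw [pow_succ, Module.End.mul_apply, ih]
      simp only [S, LinearMap.funLeft_apply]
      congr 1; push_cast; ring
  have hD : ∀ (k : ℕ) (f : ℝ → ℝ), ((1 - S) ^ k) f =
      (fun (f : ℝ → ℝ) u => f u - f (u + h))^[k] f := by
    intro k
    induction k with
    | zero => intro f; simp
    | succ k ih =>
      intro f
      rw [pow_succ, Module.End.mul_apply, ih, Function.iterate_succ_apply]
      congr 1
  have e : (1 - z) • S + z • (1 : Module.End ℝ (ℝ → ℝ)) = z • (1 - S) + S := by
    module
  have c1 : Commute ((1 - z) • S) (z • (1 : Module.End ℝ (ℝ → ℝ))) :=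
    ((Commute.one_right S).smul_left _).smul_right _
  have c2 : Commute (z • (1 - S)) S :=
    (((Commute.one_left S).sub_left (Commute.refl S)).smul_left _)
  have e1 : ∀ j m : ℕ, (((1 - z) • S) ^ j * (z • (1 : Module.End ℝ (ℝ → ℝ))) ^ m) g 0 =
      (1 - z) ^ j * z ^ m * g (j * h) := fun j m => by
    rw [smul_pow, smul_pow, one_pow, smul_mul_smul_comm, mul_one, LinearMap.smul_apply,
      Pi.smul_apply, hS, smul_eq_mul, zero_add]
  have e2 : ∀ k m : ℕ, ((z • (1 - S)) ^ k * S ^ m) g 0 =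
      z ^ k * ((fun (f : ℝ → ℝ) u => f u - f (u + h))^[k] g) (m * h) := fun k m => by
    rw [smul_pow, smul_mul_assoc, LinearMap.smul_apply, Pi.smul_apply, smul_eq_mul, ← hD,
      (((Commute.one_left S).sub_left (Commute.refl S)).pow_pow k m).eq, Module.End.mul_apply, hS,
      zero_add]
  have := congrArg (fun T : Module.End ℝ (ℝ → ℝ) => (T ^ N) g 0) e
  simp only [c1.add_pow, c2.add_pow, LinearMap.sum_apply, Finset.sum_apply,
    ← nsmul_eq_mul', LinearMap.smul_apply, Pi.smul_apply, e1, e2] at this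
  convert this using 2 with j hj k hk <;> rw [nsmul_eq_mul] <;> ring

open unitInterval in
/-- The Bernstein polynomial of `g(m ·)` at `1 - e^{-u/m}` is a combination of the powers
`e^{-uk/m}` with nonnegative coefficients of sum `g 0`, that is, an integral of `x ↦ x ^ u` over the
nodes `x = e^{-k/m}`. For large `m` the point `m (1 - e^{-u/m})` is close to `u`. -/
lemma IsDiffCM.exists_probabilityMeasure_approx {g : ℝ → ℝ} (hg : IsDiffCM g)
    (hc : ContinuousOn g (Ici 0)) (h0 : g 0 = 1) (m : ℕ) (hm : 0 < m) :
    ∃ μ : ProbabilityMeasure I, ∀ u, 0 < u →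
      |∫ x, (x : ℝ) ^ u ∂(μ : Measure I) - g (m * (1 - Real.exp (-(u / m))))| ≤ 1 / m := by
  have hm' : (0 : ℝ) < m := by exact_mod_cast hm
  let G : C(I, ℝ) := ⟨fun x => g (m * x), hc.comp_continuous (by fun_prop)
    fun x => mul_nonneg hm'.le x.2.1⟩
  -- a Bernstein polynomial of `g(m ·)` on `[0,1]`, to be evaluated at `1 - e^{-u/m}`
  obtain ⟨N, hN, hN0⟩ : ∃ N : ℕ, dist (bernsteinApproximation N G) G < 1 / m ∧ N ≠ 0 := by
    have := (Metric.tendsto_nhds.1 (bernsteinApproximation_uniform G) (1 / m) (by positivity)).and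
      (eventually_ne_atTop 0)
    exact this.exists
  have hN' : (0 : ℝ) < N := by exact_mod_cast Nat.pos_of_ne_zero hN0
  set h : ℝ := m / N with hh
  set w : ℕ → ℝ := fun k => (N.choose k : ℝ) *
        ((fun (f : ℝ → ℝ) u => f u - f (u + h))^[k] g) ((N - k : ℕ) * h) with hw
  have hw0 : ∀ k, 0 ≤ w k := fun k => mul_nonneg (by positivity)
    ((hg k).iterate_diff_nonneg (by positivity) (by positivity))
  have hB : ∀ x : I, bernsteinApproximation N G x =
      ∑ k ∈ Finset.range (N + 1), (1 - (x : ℝ)) ^ k * w k := by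
    intro x
    rw [← sum_shift_eq_sum_diff, bernsteinApproximation.apply, ← Fin.sum_univ_eq_sum_range
      (fun j => (N.choose j : ℝ) * (1 - (1 - (x : ℝ))) ^ j * (1 - (x : ℝ)) ^ (N - j) * g (j * h))]
    refine Finset.sum_congr rfl fun j _ => ?_
    rw [bernstein_apply, smul_eq_mul, sub_sub_cancel]
    congr 2
    simp only [G, ContinuousMap.coe_mk, bernstein.z, hh]
    ring_nf
  have hsum : ∑ k ∈ Finset.range (N + 1), w k = 1 := by
    have := hB 0
    rw [bernsteinApproximation.apply_zero] at this
    simpa [G, h0] using this.symm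
  -- the node `e^{-k/m}`
  let y : ℕ → I := fun k => ⟨Real.exp (-(k / m)), (Real.exp_pos _).le,
    Real.exp_le_one_iff.2 (by simp; positivity)⟩
  let μ : Measure I := ∑ k ∈ Finset.range (N + 1), ENNReal.ofReal (w k) • Measure.dirac (y k)
  have hμ : IsProbabilityMeasure μ := ⟨by
    simp only [μ, Measure.coe_finsetSum, Finset.sum_apply, Measure.smul_apply, measure_univ,
      smul_eq_mul, mul_one]
    rw [← ENNReal.ofReal_sum_of_nonneg fun k _ => hw0 k, hsum, ENNReal.ofReal_one]⟩
  refine ⟨⟨μ, hμ⟩, fun u hu => ?_⟩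
  have hint : ∫ x : I, (x : ℝ) ^ u ∂μ =
      ∑ k ∈ Finset.range (N + 1), (Real.exp (-(u / m))) ^ k * w k := by
    rw [integral_finsetSum_measure]
    · refine Finset.sum_congr rfl fun k _ => ?_
      rw [integral_smul_measure, integral_dirac, ENNReal.toReal_ofReal (hw0 k), smul_eq_mul,
        mul_comm, ← Real.exp_nat_mul]
      simp only [y]
      rw [← Real.exp_mul]
      congr 2; ring
    · exact fun k _ => (integrable_dirac (by simp)).smul_measure ENNReal.ofReal_ne_top
  let x : I := ⟨1 - Real.exp (-(u / m)), by
      simpa using (by positivity : 0 ≤ u / m), by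
      simpa using (Real.exp_pos (-(u / m))).le⟩
  have h1 := (ContinuousMap.dist_apply_le_dist (f := bernsteinApproximation N G) (g := G) x).trans
    hN.le
  rw [hB, Real.dist_eq] at h1
  simpa [hint, x, G] using h1

open unitInterval in
/-- **Bernstein's theorem** for functions continuous on the closed half-line. The measures of
`exists_probabilityMeasure_approx` have a cluster point on the compact interval `[0,1]`, and
`x = e^{-s}` turns `x ^ u` into `e^{-us}`; continuity at `0` excludes mass at `x = 0`. -/
theorem IsDiffCM.exists_laplace {g : ℝ → ℝ} (hg : IsDiffCM g) (hc : ContinuousOn g (Ici 0)) :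
    ∃ η : Measure ℝ, IsFiniteMeasure η ∧ η (Iio 0) = 0 ∧
      ∀ u, 0 ≤ u → g u = ∫ s, Real.exp (-(u * s)) ∂η := by
  wlog h0 : g 0 = 1 generalizing g
  · rcases (hg.nonneg le_rfl).eq_or_lt with h | h
    · refine ⟨0, inferInstance, by simp, fun u hu => ?_⟩
      have h1 := hg.antitone le_rfl hu
      have h2 := hg.nonneg hu
      simp; linarith
    · obtain ⟨η, hη, hη0, hη'⟩ := this (g := fun u => (g 0)⁻¹ * g u)
        (fun n => (hg n).const_mul (by positivity)) (continuousOn_const.mul hc)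
        (inv_mul_cancel₀ h.ne')
      refine ⟨ENNReal.ofReal (g 0) • η, ⟨?_⟩, by simp [hη0], fun u hu => ?_⟩
      · simpa using ENNReal.mul_lt_top ENNReal.ofReal_lt_top (measure_lt_top η univ)
      · rw [integral_smul_measure, ← hη' u hu, ENNReal.toReal_ofReal h.le, smul_eq_mul,
          mul_inv_cancel_left₀ h.ne']
  have : Nonempty (ProbabilityMeasure I) := ⟨⟨Measure.dirac 0, inferInstance⟩⟩
  -- the values at `m = 0` are irrelevant
  choose! μ hμ using hg.exists_probabilityMeasure_approx hc h0
  obtain ⟨ν, -, hν⟩ := isCompact_univ.exists_mapClusterPt (f := atTop) (u := μ) (by simp)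
  have hpow : ∀ u : ℝ, 0 < u → ∫ x : I, (x : ℝ) ^ u ∂(ν : Measure I) = g u := by
    intro u hu
    let φ : BoundedContinuousFunction I ℝ := BoundedContinuousFunction.mkOfCompact
      ⟨fun x => (x : ℝ) ^ u, by
        exact continuous_subtype_val.rpow_const fun x => Or.inr hu.le⟩
    have h1 : MapClusterPt (∫ x, φ x ∂(ν : Measure I)) atTop
        ((fun ρ : ProbabilityMeasure I => ∫ x, φ x ∂(ρ : Measure I)) ∘ μ) :=
      hν.continuousAt_comp (f := fun ρ : ProbabilityMeasure I => ∫ x, φ x ∂(ρ : Measure I)) (by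
        exact (ProbabilityMeasure.continuous_integral_boundedContinuousFunction φ).continuousAt)
    have h2 : Tendsto ((fun ρ : ProbabilityMeasure I => ∫ x, φ x ∂(ρ : Measure I)) ∘ μ) atTop
        (𝓝 (g u)) := by
      have ha : Tendsto (fun m : ℕ => (m : ℝ) * (1 - Real.exp (-(u / m)))) atTop (𝓝 u) := by
        have hd : HasDerivAt (fun t : ℝ => -Real.exp (-(u * t))) u 0 := by
          simpa using ((hasDerivAt_id' (0 : ℝ)).const_mul u).fun_neg.exp.fun_neg
        have := hd.tendsto_slope_zero_right.comp
          (tendsto_inv_atTop_nhdsGT_zero.comp tendsto_natCast_atTop_atTop)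
        refine this.congr fun m => ?_
        simp only [Function.comp_apply, inv_inv, smul_eq_mul, mul_zero, neg_zero, Real.exp_zero,
          zero_add, div_eq_mul_inv]
        ring
      have hb : Tendsto (fun m : ℕ => g (m * (1 - Real.exp (-(u / m))))) atTop (𝓝 (g u)) :=
        ((hc u hu.le).continuousAt (Ici_mem_nhds hu)).tendsto.comp ha
      have hd := squeeze_zero_norm' (a := fun m : ℕ => 1 / (m : ℝ)) (f := fun m : ℕ =>
        ∫ x : I, (x : ℝ) ^ u ∂(μ m : Measure I) - g (m * (1 - Real.exp (-(u / m))))) (by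
          filter_upwards [eventually_gt_atTop 0] with m hm using hμ m hm u hu)
          tendsto_one_div_atTop_nhds_zero_nat
      refine (zero_add (g u) ▸ hd.add hb).congr fun m => ?_
      simp [φ]
    exact eq_of_nhds_neBot (ClusterPt.mono h1 h2)
  have hzero : (ν : Measure I) {0} = 0 := by
    have hle : ∀ u : ℝ, 0 < u → g u ≤ 1 - (ν : Measure I).real {0} := by
      intro u hu
      rw [← hpow u hu, ← probReal_compl_eq_one_sub (measurableSet_singleton 0),
        ← integral_indicator_one (measurableSet_singleton 0).compl]
      refine integral_mono_of_nonneg (.of_forall fun x => Real.rpow_nonneg x.2.1 u)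
        ((integrable_const 1).indicator (measurableSet_singleton 0).compl) (.of_forall fun x => ?_)
      by_cases hx : x = 0
      · simp [hx, hu.ne']
      · simpa [indicator, hx] using Real.rpow_le_one x.2.1 x.2.2 hu.le
    have hlim : Tendsto g (𝓝[>] 0) (𝓝 (g 0)) :=
      (hc 0 self_mem_Ici).mono_left (nhdsWithin_mono _ Ioi_subset_Ici_self)
    have := le_of_tendsto hlim (eventually_mem_nhdsWithin.mono hle)
    rw [h0] at this
    exact (measureReal_eq_zero_iff).1 (le_antisymm (by linarith) measureReal_nonneg)
  have hae : ∀ᵐ x : I ∂(ν : Measure I), 0 < (x : ℝ) := by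
    have : ∀ᵐ x : I ∂(ν : Measure I), x ≠ 0 := by
      simpa [ae_iff] using hzero
    filter_upwards [this] with x hx
    exact lt_of_le_of_ne x.2.1 fun h => hx (Subtype.ext h.symm)
  have hmeas : Measurable fun x : I => -Real.log (x : ℝ) := by fun_prop
  refine ⟨(ν : Measure I).map fun x : I => -Real.log (x : ℝ), inferInstance, ?_, fun u hu => ?_⟩
  · rw [Measure.map_apply hmeas measurableSet_Iio]
    convert measure_empty (μ := (ν : Measure I))
    ext x
    simpa using Real.log_nonpos x.2.1 x.2.2
  · rw [integral_map hmeas.aemeasurable 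
      (by fun_prop : Continuous fun s : ℝ => Real.exp (-(u * s))).aestronglyMeasurable]
    rcases hu.eq_or_lt with rfl | hu
    · simp [h0]
    · rw [← hpow u hu]
      refine integral_congr_ae ?_
      filter_upwards [hae] with x hx
      rw [Real.rpow_def_of_pos hx]
      ring_nf

/-! ### Bernstein functions -/

/-- The Bernstein property in terms of differences: `f ≥ 0` vanishes at `0`, is continuous on
`[0,∞)`, and all its increments `f(· + a) - f` are completely monotone. -/
structure IsDiffBernstein (f : ℝ → ℝ) : Prop where
  zero : f 0 = 0
  continuousOn : ContinuousOn f (Ici 0)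
  increment : ∀ a, 0 ≤ a → IsDiffCM fun u => f (u + a) - f u

lemma one_sub_exp_le {u y : ℝ} (hy : 0 ≤ y) :
    1 - Real.exp (-(u * y)) ≤ max 1 u * min 1 y := by
  have h1 := Real.add_one_le_exp (-(u * y))
  have h2 := Real.exp_pos (-(u * y))
  rcases le_total 1 y with h | h
  · rw [min_eq_left h]; linarith [le_max_left 1 u]
  · rw [min_eq_right h]
    nlinarith [mul_le_mul_of_nonneg_right (le_max_right 1 u) hy]

/-- By convexity of `exp` on `[-1, 0]`. -/
lemma min_le_one_sub_exp {y : ℝ} (hy : 0 ≤ y) :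
    (1 - Real.exp (-1)) * min 1 y ≤ 1 - Real.exp (-y) := by
  rcases le_total 1 y with h | h
  · rw [min_eq_left h, mul_one]
    linarith [Real.exp_le_exp.2 (neg_le_neg h)]
  · rw [min_eq_right h]
    have := convexOn_exp.2 (mem_univ (-1 : ℝ)) (mem_univ (0 : ℝ)) hy (sub_nonneg.2 h) (by ring)
    simp only [smul_eq_mul, mul_zero, add_zero, Real.exp_zero, mul_one, mul_neg] at this
    linarith

lemma ae_nonneg_of_measure_Iio_eq_zero {η : Measure ℝ} (h : η (Iio 0) = 0) :
    ∀ᵐ s ∂η, 0 ≤ s := by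
  filter_upwards [measure_eq_zero_iff_ae_notMem.1 h] with s hs using not_lt.1 (mt mem_Iio.2 hs)

lemma integral_eq_zero_add_Ioi {E : Type*} [NormedAddCommGroup E] [NormedSpace ℝ E]
    [CompleteSpace E] {η : Measure ℝ} (h : η (Iio 0) = 0) {g : ℝ → E} (hg : Integrable g η) :
    ∫ s, g s ∂η = η.real {0} • g 0 + ∫ s in Ioi 0, g s ∂η := by
  have : η.restrict (Ici 0) = η := Measure.restrict_eq_self_of_ae_mem
    (ae_nonneg_of_measure_Iio_eq_zero h)
  conv_lhs => rw [← this, ← Ioi_union_left, union_comm]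
  rw [setIntegral_union (by simp) measurableSet_Ioi hg.integrableOn hg.integrableOn,
    integral_singleton]

lemma integrable_exp_neg_mul {η : Measure ℝ} [IsFiniteMeasure η] (h : η (Iio 0) = 0) {u : ℝ}
    (hu : 0 ≤ u) : Integrable (fun s => Real.exp (-(u * s))) η := by
  refine (integrable_const (1 : ℝ)).mono' (by fun_prop) ?_
  filter_upwards [ae_nonneg_of_measure_Iio_eq_zero h] with s hs
  rw [Real.norm_of_nonneg (Real.exp_pos _).le]
  exact Real.exp_le_one_iff.2 (by simpa using mul_nonneg hu hs)

section
variable {μ : Measure ℝ}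

lemma integrableOn_min_one (hμ : ∫⁻ y in Ioi 0, ENNReal.ofReal (min 1 y) ∂μ < ∞) :
    IntegrableOn (fun y : ℝ => min 1 y) (Ioi 0) μ := by
  refine ⟨by fun_prop, ?_⟩
  rw [hasFiniteIntegral_iff_ofReal]
  · exact hμ
  · filter_upwards [ae_restrict_mem measurableSet_Ioi] with y hy
    exact le_min zero_le_one (le_of_lt hy)

lemma integrableOn_one_sub_exp (hμ : ∫⁻ y in Ioi 0, ENNReal.ofReal (min 1 y) ∂μ < ∞) {u : ℝ}
    (hu : 0 ≤ u) : IntegrableOn (fun y : ℝ => 1 - Real.exp (-(u * y))) (Ioi 0) μ := by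
  refine ((integrableOn_min_one hμ).const_mul (max 1 u)).mono' (by fun_prop) ?_
  filter_upwards [ae_restrict_mem measurableSet_Ioi] with y hy
  rw [Real.norm_of_nonneg]
  · exact one_sub_exp_le (le_of_lt hy)
  · have : 0 ≤ u * y := mul_nonneg hu (le_of_lt hy)
    simpa using this

end

lemma IsBernstein.isDiffBernstein {f : ℝ → ℝ} (hf : IsBernstein f) : IsDiffBernstein f := by
  obtain ⟨α, μ, hα, hμ, hfμ⟩ := hf
  refine ⟨by simp [hfμ 0 le_rfl], ?_, fun a ha => ?_⟩
  · have hc : ContinuousOn (fun u => α * u + ∫ y in Ioi 0, (1 - Real.exp (-(u * y))) ∂μ)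
        (Ici 0) := by
      refine (by fun_prop : ContinuousOn (fun u : ℝ => α * u) _).add fun u₀ hu₀ => ?_
      refine continuousWithinAt_of_dominated (bound := fun y => (u₀ + 2) * min 1 y)
        (.of_forall fun u => by fun_prop) ?_ ((integrableOn_min_one hμ).const_mul _)
        (.of_forall fun y => by fun_prop)
      have h1 : ∀ᶠ u in 𝓝[Ici 0] u₀, u < u₀ + 1 :=
        nhdsWithin_le_nhds (Iio_mem_nhds (by linarith))
      filter_upwards [h1, self_mem_nhdsWithin] with u hu hu'
      filter_upwards [ae_restrict_mem measurableSet_Ioi] with y hy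
      have hy' : 0 ≤ y := le_of_lt hy
      have : 0 ≤ u * y := mul_nonneg hu' hy'
      rw [Real.norm_of_nonneg (by simpa using this)]
      refine (one_sub_exp_le hy').trans ?_
      have h0 : (0 : ℝ) ≤ u₀ := hu₀
      have : max 1 u ≤ u₀ + 2 := max_le (by linarith) (by linarith)
      exact mul_le_mul_of_nonneg_right this (le_min zero_le_one hy')
    exact hc.congr hfμ
  · have h1 : IsDiffCM fun u => ∫ y in Ioi 0, (1 - Real.exp (-(a * y))) *
        Real.exp (-(u * y)) ∂μ := by
      refine isDiffCM_integral (integrableOn_one_sub_exp hμ ha) ?_ measurable_id ?_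
      · filter_upwards [ae_restrict_mem measurableSet_Ioi] with y hy
        have : 0 ≤ a * y := mul_nonneg ha (le_of_lt hy)
        simpa using this
      · filter_upwards [ae_restrict_mem measurableSet_Ioi] with y hy using le_of_lt hy
    refine fun n => ((DiffMonotone.const (mul_nonneg hα ha) n).add (h1 n)).congr fun u hu => ?_
    rw [hfμ u hu, hfμ _ (by positivity)]
    have : ∫ y in Ioi 0, (1 - Real.exp (-(a * y))) * Real.exp (-(u * y)) ∂μ =
        (∫ y in Ioi 0, (1 - Real.exp (-((u + a) * y))) ∂μ) -
          ∫ y in Ioi 0, (1 - Real.exp (-(u * y))) ∂μ := by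
      rw [← integral_sub (integrableOn_one_sub_exp hμ (by positivity))
        (integrableOn_one_sub_exp hμ hu)]
      congr 1 with y
      rw [add_mul, neg_add, Real.exp_add]
      ring
    rw [this]; ring

namespace IsDiffBernstein

variable {f : ℝ → ℝ}

lemma monotoneOn (hf : IsDiffBernstein f) : MonotoneOn f (Ici 0) := fun u hu v _ huv => by
  have := (hf.increment _ (sub_nonneg.2 huv)).nonneg hu
  simpa using this

lemma nonneg (hf : IsDiffBernstein f) {u : ℝ} (hu : 0 ≤ u) : 0 ≤ f u :=
  hf.zero ▸ hf.monotoneOn self_mem_Ici hu hu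

/-- With `r = 1 / (1 + f)`, `r - r(· + h) = (f(· + h) - f) r r(· + h)`, which gives the orders of
monotonicity of `r` one after the other. -/
lemma isDiffCM_inv_one_add (hf : IsDiffBernstein f) : IsDiffCM fun u => (1 + f u)⁻¹ := by
  intro n
  have h0 : ∀ u, 0 ≤ u → 0 < 1 + f u := fun u hu => by linarith [hf.nonneg hu]
  induction n with
  | zero => exact fun u hu => (inv_pos.2 (h0 u hu)).le
  | succ n ih =>
    refine ⟨ih, fun h hh => (((hf.increment h hh n).mul ih).mul (ih.comp_add hh)).congr
      fun u hu => ?_⟩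
    have h1 := (h0 u hu).ne'
    have h2 := (h0 (u + h) (by positivity)).ne'
    field_simp
    ring

lemma const_mul (hf : IsDiffBernstein f) {c : ℝ} (hc : 0 ≤ c) :
    IsDiffBernstein fun u => c * f u :=
  ⟨by simp [hf.zero], continuousOn_const.mul hf.continuousOn, fun a ha n =>
    ((hf.increment a ha n).const_mul hc).congr fun u _ => by ring⟩

/-- `e^{-f}` is the limit of `(1 + f/n)^{-n}`. -/
lemma isDiffCM_exp_neg (hf : IsDiffBernstein f) : IsDiffCM fun u => Real.exp (-f u) := by
  intro n
  refine DiffMonotone.of_tendsto (l := atTop)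
    (F := fun (m : ℕ) u => ((1 + (m : ℝ)⁻¹ * f u)⁻¹) ^ m)
    (.of_forall fun m => ((hf.const_mul (by positivity)).isDiffCM_inv_one_add n).pow m)
    fun u hu => ?_
  rw [Real.exp_neg]
  refine ((Real.tendsto_one_add_div_pow_exp (f u)).inv₀ (Real.exp_pos _).ne').congr fun m => ?_
  rw [inv_pow, div_eq_inv_mul]

/-- The increment `P(· + a) - P` is periodic and convergent, hence constant; so `P` is additive,
and an additive bounded function vanishes. -/
lemma eq_zero_of_periodic {P : ℝ → ℝ} (h0 : P 0 = 0) (hper : ∀ u, 0 ≤ u → P (u + 1) = P u)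
    (hlim : ∀ a, 0 ≤ a → ∃ L, Tendsto (fun u => P (u + a) - P u) atTop (𝓝 L))
    {C : ℝ} (hC : ∀ u ∈ Icc (0 : ℝ) 1, |P u| ≤ C) {u : ℝ} (hu : 0 ≤ u) : P u = 0 := by
  have hper' : ∀ (n : ℕ) u, 0 ≤ u → P (u + n) = P u := by
    intro n
    induction n with
    | zero => simp
    | succ n ih =>
      intro u hu
      rw [Nat.cast_succ, ← add_assoc, hper _ (by positivity), ih u hu]
  have hadd : ∀ a, 0 ≤ a → ∀ u, 0 ≤ u → P (u + a) - P u = P a := by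
    intro a ha
    obtain ⟨L, hL⟩ := hlim a ha
    have : ∀ u, 0 ≤ u → P (u + a) - P u = L := fun u hu => by
      have h1 := hL.comp (tendsto_atTop_add_const_left _ u tendsto_natCast_atTop_atTop)
      refine tendsto_nhds_unique (tendsto_const_nhds.congr fun n => ?_) h1
      simp only [Function.comp_apply]
      rw [hper' n u hu, add_right_comm, hper' n _ (by positivity)]
    intro u hu
    rw [this u hu, ← this 0 le_rfl, h0, zero_add, sub_zero]
  have hmul : ∀ n : ℕ, P (n * u) = n * P u := by
    intro n
    induction n with
    | zero => simp [h0]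
    | succ n ih =>
      have := hadd u hu (n * u) (by positivity)
      rw [Nat.cast_succ, add_mul, one_mul, add_mul, one_mul]
      linarith
  have hbd : ∀ v, 0 ≤ v → |P v| ≤ C := fun v hv => by
    have := hper' ⌊v⌋₊ (Int.fract v) (Int.fract_nonneg v)
    have hv' : Int.fract v + (⌊v⌋₊ : ℝ) = v := by
      rw [natCast_floor_eq_intCast_floor hv, Int.fract_add_floor]
    rw [hv'] at this
    rw [this]
    exact hC _ ⟨Int.fract_nonneg v, (Int.fract_lt_one v).le⟩
  by_contra hne
  have hpos := abs_pos.2 hne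
  obtain ⟨n, hn⟩ := exists_nat_gt (C / |P u|)
  have := hbd (n * u) (by positivity)
  rw [hmul, abs_mul, Nat.abs_cast] at this
  rw [div_lt_iff₀ hpos] at hn
  linarith

lemma exists_tendsto_increment (hf : IsDiffBernstein f) {a : ℝ} (ha : 0 ≤ a) :
    ∃ L, Tendsto (fun u => f (u + a) - f u) atTop (𝓝 L) := by
  have hg := hf.increment a ha
  have h1 : Antitone fun u => f (max u 0 + a) - f (max u 0) := fun u v huv =>
    hg.antitone (le_max_right u 0) (max_le_max_right 0 huv)
  have h2 : BddBelow (range fun u => f (max u 0 + a) - f (max u 0)) :=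
    ⟨0, by rintro _ ⟨u, rfl⟩; exact hg.nonneg (le_max_right u 0)⟩
  refine ⟨_, (tendsto_atTop_ciInf h1 h2).congr' ?_⟩
  filter_upwards [eventually_ge_atTop 0] with u hu
  rw [max_eq_left hu]

/-- If `f(u + 1) - f(u) = ∫ e^{-us} ρ(ds)`, then `α = ρ {0}` and `μ(ds) = (1 - e^{-s})⁻¹ ρ(ds)`
represent `f`. -/
theorem isBernstein (hf : IsDiffBernstein f) : IsBernstein f := by
  -- the representation of one increment determines `f` up to a `1`-periodic function
  obtain ⟨ρ, hρ, hρ0, hρf⟩ := (hf.increment 1 zero_le_one).exists_laplace (by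
    refine ContinuousOn.sub (hf.continuousOn.comp (by fun_prop) fun u hu => ?_) hf.continuousOn
    simp only [mem_Ici] at *; positivity)
  set α : ℝ := ρ.real {0}
  set d : ℝ → ℝ≥0∞ := fun s => ENNReal.ofReal (1 - Real.exp (-s))⁻¹ with hd
  have hdm : Measurable d := by fun_prop
  set μ : Measure ℝ := ρ.withDensity d
  have hr : μ.restrict (Ioi 0) = (ρ.restrict (Ioi 0)).withDensity d :=
    restrict_withDensity measurableSet_Ioi d
  have hpos : ∀ s : ℝ, 0 < s → 0 < 1 - Real.exp (-s) := fun s hs => by simpa using hs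
  have hμ : ∫⁻ y in Ioi 0, ENNReal.ofReal (min 1 y) ∂μ < ∞ := by
    rw [hr, lintegral_withDensity_eq_lintegral_mul _ hdm (by fun_prop)]
    calc _ ≤ ∫⁻ y in Ioi 0, ENNReal.ofReal (1 - Real.exp (-1))⁻¹ ∂ρ := by
          refine setLIntegral_mono (by fun_prop) fun y hy => ?_
          have h1 := hpos y hy
          rw [Pi.mul_apply, hd, ← ENNReal.ofReal_mul (inv_nonneg.2 h1.le)]
          refine ENNReal.ofReal_le_ofReal ?_
          rw [inv_mul_le_iff₀ h1, ← div_eq_mul_inv, le_div_iff₀' (hpos 1 one_pos)]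
          exact min_le_one_sub_exp (le_of_lt hy)
      _ < ∞ := by
          rw [lintegral_const]
          exact ENNReal.mul_lt_top ENNReal.ofReal_lt_top (measure_lt_top _ _)
  set F : ℝ → ℝ := fun u => α * u + ∫ y in Ioi 0, (1 - Real.exp (-(u * y))) ∂μ
  have hFB : IsBernstein F := ⟨α, μ, measureReal_nonneg, hμ, fun u _ => rfl⟩
  have hF := hFB.isDiffBernstein
  refine ⟨α, μ, measureReal_nonneg, hμ, fun u hu => ?_⟩
  suffices h : f u - F u = 0 from sub_eq_zero.1 h
  have hstep : ∀ u, 0 ≤ u → F (u + 1) - F u = f (u + 1) - f u := by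
    intro u hu
    rw [hρf u hu]
    have h1 : F (u + 1) - F u =
        α + ∫ y in Ioi 0, (1 - Real.exp (-y)) * Real.exp (-(u * y)) ∂μ := by
      have : ∫ y in Ioi 0, (1 - Real.exp (-y)) * Real.exp (-(u * y)) ∂μ =
          (∫ y in Ioi 0, (1 - Real.exp (-((u + 1) * y))) ∂μ) -
            ∫ y in Ioi 0, (1 - Real.exp (-(u * y))) ∂μ := by
        rw [← integral_sub (integrableOn_one_sub_exp hμ (by positivity))
          (integrableOn_one_sub_exp hμ hu)]
        congr 1 with y
        rw [add_mul, neg_add, Real.exp_add, one_mul]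
        ring
      rw [this]; simp only [F]; ring
    have h2 : ∫ y in Ioi 0, (1 - Real.exp (-y)) * Real.exp (-(u * y)) ∂μ =
        ∫ y in Ioi 0, Real.exp (-(u * y)) ∂ρ := by
      rw [hr, integral_withDensity_eq_integral_toReal_smul hdm
        (.of_forall fun s => ENNReal.ofReal_lt_top)]
      refine setIntegral_congr_fun measurableSet_Ioi fun y hy => ?_
      have h1 := hpos y hy
      simp only [hd]
      rw [ENNReal.toReal_ofReal (inv_nonneg.2 h1.le), smul_eq_mul, inv_mul_cancel_left₀ h1.ne']
    rw [h1, h2, integral_eq_zero_add_Ioi hρ0 (integrable_exp_neg_mul hρ0 hu)]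
    simp [α]
  refine eq_zero_of_periodic (P := fun u => f u - F u) (by simp [hf.zero, hF.zero])
    (fun u hu => by linarith [hstep u hu]) (fun a ha => ?_) (C := f 1 + F 1) (fun v hv => ?_) hu
  · obtain ⟨L, hL⟩ := hf.exists_tendsto_increment ha
    obtain ⟨L', hL'⟩ := hF.exists_tendsto_increment ha
    exact ⟨L - L', (hL.sub hL').congr fun u => by ring⟩
  · have h1 := hf.nonneg hv.1
    have h2 := hF.nonneg hv.1
    have h3 := hf.monotoneOn hv.1 (mem_Ici.2 zero_le_one) hv.2
    have h4 := hF.monotoneOn hv.1 (mem_Ici.2 zero_le_one) hv.2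
    rw [abs_le]; constructor <;> linarith

/-- The laws `η_t` of the subordinator with Laplace exponent `f`. -/
theorem exists_subordinator (hf : IsDiffBernstein f) {t : ℝ} (ht : 0 ≤ t) :
    ∃ η : Measure ℝ, IsProbabilityMeasure η ∧ η (Iio 0) = 0 ∧
      ∀ u, 0 ≤ u → ∫ s, Real.exp (-(u * s)) ∂η = Real.exp (-(t * f u)) := by
  have h := hf.const_mul ht
  obtain ⟨η, hη, hη0, hη'⟩ := h.isDiffCM_exp_neg.exists_laplace
    h.continuousOn.neg.rexp
  refine ⟨η, ⟨?_⟩, hη0, fun u hu => (hη' u hu).symm⟩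
  have := hη' 0 le_rfl
  simp only [hf.zero, mul_zero, neg_zero, Real.exp_zero, zero_mul, integral_const, smul_eq_mul,
    mul_one] at this
  rw [← ENNReal.ofReal_one, this, ofReal_measureReal]

end IsDiffBernstein

/-! ### Radial negative definite functions in all dimensions -/

/-- The quadratic form with coefficients `c` of the kernel `F(|x - y|²)` at the points `x i`. -/
def radialForm {ι κ : Type} [Fintype ι] [Fintype κ] (F : ℝ → ℝ) (x : ι → κ → ℝ) (c : ι → ℝ) : ℝ :=
  ∑ i, ∑ j, c i * c j * F (∑ k, (x i k - x j k) ^ 2)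

/-- `F(|x - y|²)` is a positive definite kernel on every finite-dimensional Euclidean space. -/
def IsRadialPD (F : ℝ → ℝ) : Prop :=
  ∀ (ι κ : Type) [Fintype ι] [Fintype κ] (x : ι → κ → ℝ) (c : ι → ℝ), 0 ≤ radialForm F x c

/-- `F(|x - y|²)` is a conditionally positive definite kernel on every finite-dimensional Euclidean
space: only coefficients with sum `0` are allowed. -/
def IsRadialCPD (F : ℝ → ℝ) : Prop :=
  ∀ (ι κ : Type) [Fintype ι] [Fintype κ] (x : ι → κ → ℝ) (c : ι → ℝ), ∑ i, c i = 0 →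
    0 ≤ radialForm F x c

section
variable {ι κ : Type} [Fintype ι] [Fintype κ]

lemma radialForm_add (F G : ℝ → ℝ) (x : ι → κ → ℝ) (c : ι → ℝ) :
    radialForm (fun u => F u + G u) x c = radialForm F x c + radialForm G x c := by
  simp only [radialForm, mul_add, Finset.sum_add_distrib]

lemma radialForm_const_mul (F : ℝ → ℝ) (x : ι → κ → ℝ) (c : ι → ℝ) (a : ℝ) :
    radialForm (fun u => a * F u) x c = a * radialForm F x c := by
  simp only [radialForm, Finset.mul_sum]
  exact Finset.sum_congr rfl fun i _ => Finset.sum_congr rfl fun j _ => by ring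

/-- Each point `x i` is kept, with coefficient `a c i`, and completed by its translates along `M`
new orthogonal directions by `√h`, with coefficients `b c i / M`. The squared distances in the new
configuration are shifted by `0`, `h`, or `2h`. -/
lemma radialForm_translates (F : ℝ → ℝ) (x : ι → κ → ℝ) (c : ι → ℝ) {h : ℝ} (hh : 0 ≤ h)
    (a b : ℝ) {M : ℕ} (hM : M ≠ 0) :
    radialForm F
      (Sum.elim (fun i => Sum.elim (x i) 0)
        (fun ip => Sum.elim (x ip.1) (Pi.single ip.2 (√h))) : ι ⊕ (ι × Fin M) → κ ⊕ Fin M → ℝ)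
      (Sum.elim (fun i => a * c i) (fun ip => b * c ip.1 / M)) =
    a ^ 2 * radialForm F x c + 2 * a * b * radialForm (fun u => F (u + h)) x c +
      b ^ 2 * ((1 - 1 / M) * radialForm (fun u => F (u + 2 * h)) x c +
        1 / M * radialForm F x c) := by
  have hM' : (M : ℝ) ≠ 0 := by exact_mod_cast hM
  have hs : √h ^ 2 = h := Real.sq_sqrt hh
  have h1 : ∀ p : Fin M, ∑ k, ((Pi.single p (√h) : Fin M → ℝ) k) ^ 2 = h := fun p => by
    simp [Pi.single_apply, hs]
  have h2 : ∀ p q : Fin M, ∑ k, ((Pi.single p (√h) : Fin M → ℝ) k -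
      (Pi.single q (√h) : Fin M → ℝ) k) ^ 2 = if p = q then 0 else 2 * h := fun p q => by
    split_ifs with hpq
    · simp [hpq]
    · simp only [sub_sq, Finset.sum_add_distrib, Finset.sum_sub_distrib, h1]
      have : ∀ k, 2 * (Pi.single p (√h) : Fin M → ℝ) k * (Pi.single q (√h) : Fin M → ℝ) k = 0 :=
        fun k => by
          rcases eq_or_ne k p with rfl | hk
          · simp [hpq]
          · simp [hk]
      simp only [this, Finset.sum_const_zero]
      ring
  have h3 : ∀ i j : ι, ∑ p : Fin M, ∑ q : Fin M, (b * c i / M) * (b * c j / M) *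
      F ((∑ k, (x i k - x j k) ^ 2) + if p = q then 0 else 2 * h) =
      b ^ 2 * ((1 - 1 / M) * (c i * c j * F ((∑ k, (x i k - x j k) ^ 2) + 2 * h)) +
        1 / M * (c i * c j * F (∑ k, (x i k - x j k) ^ 2))) := by
    intro i j
    set d := ∑ k, (x i k - x j k) ^ 2
    have : ∀ p q : Fin M, F (d + if p = q then 0 else 2 * h) =
        F (d + 2 * h) + if p = q then F d - F (d + 2 * h) else 0 := fun p q => by
      split_ifs <;> simp
    simp only [this, mul_add, Finset.sum_add_distrib, mul_ite, mul_zero, Finset.sum_ite_eq,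
      Finset.mem_univ, if_true, Finset.sum_const, Finset.card_univ, Fintype.card_fin,
      nsmul_eq_mul]
    field_simp
    ring
  simp only [radialForm, Fintype.sum_sum_type, Sum.elim_inl, Sum.elim_inr, Pi.zero_apply,
    zero_sub, sub_zero, neg_sq, h1, h2, Fintype.sum_prod_type, ne_eq, OfNat.ofNat_ne_zero,
    not_false_eq_true, zero_pow, Finset.sum_const_zero, add_zero, Finset.sum_add_distrib,
    Finset.sum_const, Finset.card_univ, Fintype.card_fin, nsmul_eq_mul]
  have h4 : ∀ i : ι, ∑ p : Fin M, ∑ j : ι, ∑ q : Fin M, (b * c i / M) * (b * c j / M) *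
      F ((∑ k, (x i k - x j k) ^ 2) + if p = q then 0 else 2 * h) = ∑ j : ι,
      b ^ 2 * ((1 - 1 / M) * (c i * c j * F ((∑ k, (x i k - x j k) ^ 2) + 2 * h)) +
        1 / M * (c i * c j * F (∑ k, (x i k - x j k) ^ 2))) := fun i => by
    rw [Finset.sum_comm]
    exact Finset.sum_congr rfl fun j _ => h3 i j
  simp only [h4]
  simp only [Finset.mul_sum, ← Finset.sum_add_distrib]
  refine Finset.sum_congr rfl fun i _ => Finset.sum_congr rfl fun j _ => ?_
  field_simp
  ring

/-- The limit `M → ∞` of `radialForm_translates`. -/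
lemma radialForm_shift_nonneg {F : ℝ → ℝ} {x : ι → κ → ℝ} {c : ι → ℝ} {h : ℝ} (hh : 0 ≤ h)
    {a b : ℝ}
    (H : IsRadialPD F ∨ IsRadialCPD F ∧ a + b = 0) :
    0 ≤ a ^ 2 * radialForm F x c + 2 * a * b * radialForm (fun u => F (u + h)) x c +
      b ^ 2 * radialForm (fun u => F (u + 2 * h)) x c := by
  have hlim : Tendsto (fun M : ℕ => a ^ 2 * radialForm F x c +
      2 * a * b * radialForm (fun u => F (u + h)) x c +
      b ^ 2 * ((1 - 1 / (M : ℝ)) * radialForm (fun u => F (u + 2 * h)) x c +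
        1 / (M : ℝ) * radialForm F x c)) atTop (𝓝 (a ^ 2 * radialForm F x c +
      2 * a * b * radialForm (fun u => F (u + h)) x c +
      b ^ 2 * ((1 - 0) * radialForm (fun u => F (u + 2 * h)) x c + 0 * radialForm F x c))) := by
    have := tendsto_one_div_atTop_nhds_zero_nat (𝕜 := ℝ)
    exact tendsto_const_nhds.add ((((tendsto_const_nhds.sub this).mul_const _).add
      (this.mul_const _)).const_mul _)
  rw [sub_zero, one_mul, zero_mul, add_zero] at hlim
  refine ge_of_tendsto hlim ?_
  filter_upwards [eventually_ne_atTop 0] with M hM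
  have hM' : (M : ℝ) ≠ 0 := by exact_mod_cast hM
  rw [← radialForm_translates F x c hh a b hM]
  rcases H with H | ⟨H, hab⟩
  · exact H _ _ _ _
  · refine H _ _ _ _ ?_
    simp only [Fintype.sum_sum_type, Sum.elim_inl, Sum.elim_inr, Fintype.sum_prod_type,
      Finset.sum_const, Finset.card_univ, Fintype.card_fin, nsmul_eq_mul]
    rw [← Finset.sum_add_distrib]
    refine Finset.sum_eq_zero fun i _ => ?_
    field_simp
    rw [hab, mul_zero]

end

lemma IsRadialPD.comp_add {F : ℝ → ℝ} (hF : IsRadialPD F) {h : ℝ} (hh : 0 ≤ h) :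
    IsRadialPD fun u => F (u + h) := fun ι κ _ _ x c => by
  have := radialForm_shift_nonneg (x := x) (c := c) (h := h / 2) (a := 0) (b := 1) (by positivity)
    (Or.inl hF)
  simpa [mul_div_cancel₀] using this

lemma IsRadialCPD.second_diff {F : ℝ → ℝ} (hF : IsRadialCPD F) {h : ℝ} (hh : 0 ≤ h) :
    IsRadialPD fun u => F u + -2 * F (u + h) + F (u + 2 * h) := fun ι κ _ _ x c => by
  have := radialForm_shift_nonneg (x := x) (c := c) (a := 1) (b := -1) hh
    (Or.inr ⟨hF, by norm_num⟩)
  rw [radialForm_add, radialForm_add, radialForm_const_mul]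
  linarith

lemma IsRadialPD.isRadialCPD {F : ℝ → ℝ} (hF : IsRadialPD F) : IsRadialCPD F :=
  fun ι κ _ _ x c _ => hF ι κ x c

lemma IsRadialPD.nonneg {F : ℝ → ℝ} (hF : IsRadialPD F) {u : ℝ} (hu : 0 ≤ u) : 0 ≤ F u := by
  simpa [radialForm] using hF.comp_add hu Unit Unit 0 1

lemma IsRadialPD.le_zero {F : ℝ → ℝ} (hF : IsRadialPD F) {u : ℝ} (hu : 0 ≤ u) : F u ≤ F 0 := by
  have := hF (Fin 2) Unit ![0, fun _ => √u] ![1, -1]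
  simp [radialForm, Fin.sum_univ_two, Real.sq_sqrt hu] at this
  linarith

/-- A convex sequence with an upper bound that does not grow linearly cannot increase. -/
lemma le_of_convex_seq {q B : ℕ → ℝ} {L : ℝ} (hq : ∀ j, 0 ≤ q j + -2 * q (j + 1) + q (j + 2))
    (hB : ∀ j, q j ≤ B j) (hL : Tendsto (fun j : ℕ => B j / j) atTop (𝓝 L)) (hL0 : L ≤ 0) :
    q 1 ≤ q 0 := by
  have hinc : ∀ j, q 1 - q 0 ≤ q (j + 1) - q j := by
    intro j
    induction j with
    | zero => simp
    | succ j ih => linarith [hq j]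
  have hlin : ∀ j : ℕ, q 0 + j * (q 1 - q 0) ≤ q j := by
    intro j
    induction j with
    | zero => simp
    | succ j ih => push_cast; linarith [hinc j]
  have h1 : Tendsto (fun j : ℕ => q 0 / j + (q 1 - q 0)) atTop (𝓝 (0 + (q 1 - q 0))) :=
    (tendsto_const_div_atTop_nhds_zero_nat _).add tendsto_const_nhds
  have := le_of_tendsto_of_tendsto h1 hL (by
    filter_upwards [eventually_gt_atTop 0] with j hj
    have hj' : (0 : ℝ) < j := by exact_mod_cast hj
    rw [div_add' _ _ _ hj'.ne']
    gcongr
    linarith [hlin j, hB j])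
  linarith

/-- The sequence `j ↦ radialForm F(· + jh)` is convex as soon as second differences of `F` are
positive definite. -/
lemma radialForm_convex {F : ℝ → ℝ} {h : ℝ} (hh : 0 ≤ h)
    (hF : IsRadialPD fun u => F u + -2 * F (u + h) + F (u + 2 * h)) {ι κ : Type} [Fintype ι]
    [Fintype κ] (x : ι → κ → ℝ) (c : ι → ℝ) (j : ℕ) :
    0 ≤ radialForm (fun u => F (u + j * h)) x c +
      -2 * radialForm (fun u => F (u + (j + 1 : ℕ) * h)) x c +
      radialForm (fun u => F (u + (j + 2 : ℕ) * h)) x c := by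
  have := hF.comp_add (h := j * h) (by positivity) ι κ x c
  rw [radialForm_add, radialForm_add, radialForm_const_mul] at this
  have e1 : ∀ u : ℝ, u + (j + 1 : ℕ) * h = u + j * h + h := fun u => by push_cast; ring
  have e2 : ∀ u : ℝ, u + (j + 2 : ℕ) * h = u + j * h + 2 * h := fun u => by push_cast; ring
  simp only [e1, e2]
  exact this

/-- The sequence `j ↦ radialForm F(· + jh)` is convex and bounded, hence decreasing. -/
lemma IsRadialPD.diff {F : ℝ → ℝ} (hF : IsRadialPD F) {h : ℝ} (hh : 0 ≤ h) :
    IsRadialPD fun u => F u + -1 * F (u + h) := fun ι κ _ _ x c => by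
  have hsq : ∀ i j, 0 ≤ ∑ k, (x i k - x j k) ^ 2 := fun i j =>
    Finset.sum_nonneg fun k _ => sq_nonneg _
  have := le_of_convex_seq (B := fun _ => ∑ i, ∑ j, |c i * c j| * F 0)
    (radialForm_convex hh (hF.isRadialCPD.second_diff hh) x c) (fun m => ?_)
    (tendsto_const_div_atTop_nhds_zero_nat _) le_rfl
  · rw [radialForm_add, radialForm_const_mul]
    simp only [Nat.cast_one, one_mul, Nat.cast_zero, zero_mul, add_zero] at this
    linarith
  · refine Finset.sum_le_sum fun i _ => Finset.sum_le_sum fun j _ => ?_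
    have h0 := hsq i j
    have h1 := hF.nonneg (u := (∑ k, (x i k - x j k) ^ 2) + m * h) (by positivity)
    have h2 := hF.le_zero (u := (∑ k, (x i k - x j k) ^ 2) + m * h) (by positivity)
    exact mul_le_mul (le_abs_self _) h2 h1 (abs_nonneg _)

/-- **Schoenberg's theorem**, in terms of differences. -/
lemma IsRadialPD.isDiffCM {F : ℝ → ℝ} (hF : IsRadialPD F) : IsDiffCM F := by
  intro n
  induction n generalizing F with
  | zero => exact fun u hu => hF.nonneg hu
  | succ n ih => exact ⟨ih hF, fun h hh => (ih (hF.diff hh)).congr fun u _ => by ring⟩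

section
variable {f : ℝ → ℝ}

/-- A nonnegative concave sequence is increasing. -/
lemma IsRadialCPD.monotoneOn_neg (hf : IsRadialCPD fun u => -f u) (hf0 : ∀ u, 0 ≤ u → 0 ≤ f u)
    {u h : ℝ} (hu : 0 ≤ u) (hh : 0 ≤ h) : f u ≤ f (u + h) := by
  have := le_of_convex_seq (q := fun j => -f (u + j * h)) (B := fun _ => 0) (fun j => ?_)
    (fun j => neg_nonpos.2 (hf0 _ (by positivity))) (tendsto_const_div_atTop_nhds_zero_nat _) le_rfl
  · simpa using this
  · have := (hf.second_diff hh).nonneg (u := u + j * h) (by positivity)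
    push_cast
    convert this using 3 <;> ring_nf

/-- `f` grows linearly, with the same rate along all arithmetic progressions of step `a`. -/
lemma IsRadialCPD.exists_rate (hf : IsRadialCPD fun u => -f u) (hf0 : ∀ u, 0 ≤ u → 0 ≤ f u)
    {a : ℝ} (ha : 0 < a) :
    ∃ L : ℝ, 0 ≤ L ∧ ∀ d, 0 ≤ d → Tendsto (fun j : ℕ => f (d + j * a) / j) atTop (𝓝 L) := by
  -- the increments along `0, a, 2a, …` decrease to a limit, which is the rate by Cesàro's theorem
  set Δ : ℕ → ℝ := fun j => f ((j + 1 : ℕ) * a) - f (j * a) with hΔ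
  have hΔ0 : ∀ j, 0 ≤ Δ j := fun j => by
    have := hf.monotoneOn_neg hf0 (u := j * a) (by positivity) ha.le
    simp only [hΔ]; push_cast; rw [add_mul, one_mul]; linarith
  have hanti : Antitone Δ := antitone_nat_of_succ_le fun j => by
    have := (hf.second_diff ha.le).nonneg (u := j * a) (by positivity)
    simp only [hΔ]
    push_cast
    have e1 : ((j : ℝ) + 1) * a = j * a + a := by ring
    have e2 : ((j : ℝ) + 1 + 1) * a = j * a + 2 * a := by ring
    rw [e1, e2]; linarith
  have hL := tendsto_atTop_ciInf hanti ⟨0, by rintro _ ⟨j, rfl⟩; exact hΔ0 j⟩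
  set L := ⨅ j, Δ j
  refine ⟨L, le_ciInf hΔ0, fun d hd => ?_⟩
  have h0 : Tendsto (fun j : ℕ => f (j * a) / j) atTop (𝓝 L) := by
    have h1 := hL.cesaro
    simp only [hΔ] at h1
    simp only [Finset.sum_range_sub (fun j : ℕ => f (j * a))] at h1
    have h2 := h1.add (tendsto_const_div_atTop_nhds_zero_nat (f ((0 : ℕ) * a)))
    rw [add_zero] at h2
    refine h2.congr fun j => ?_
    ring
  obtain ⟨m, hm⟩ := exists_nat_ge (d / a)
  rw [div_le_iff₀ ha] at hm
  have hup : ∀ m j : ℕ, f ((j + m : ℕ) * a) ≤ f (j * a) + m * Δ 0 := by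
    intro m j
    induction m with
    | zero => simp
    | succ m ih =>
      have h1 := hanti (Nat.zero_le (j + m))
      have h2 : Δ (j + m) = f ((j + (m + 1) : ℕ) * a) - f ((j + m : ℕ) * a) := by
        simp only [hΔ, add_assoc]
      push_cast at *
      linarith
  refine tendsto_of_tendsto_of_tendsto_of_le_of_le h0 (g := fun j : ℕ => f (j * a) / j)
    (h := fun j : ℕ => f (j * a) / j + m * Δ 0 / j) ?_ (fun j => ?_) fun j => ?_
  · simpa using h0.add (tendsto_const_div_atTop_nhds_zero_nat (m * Δ 0))
  · have := hf.monotoneOn_neg hf0 (u := j * a) (by positivity) hd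
    simp only
    rw [add_comm d]; gcongr
  · have h1 := hf.monotoneOn_neg hf0 (u := d + j * a) (h := m * a - d) (by positivity)
      (by linarith)
    have h2 := hup m j
    push_cast at h2
    have e : d + j * a + (m * a - d) = (j + m) * a := by ring
    rw [e] at h1
    simp only
    rw [← add_div]
    gcongr
    linarith

/-- The increments of a radial negative definite function are positive definite: the convex sequence
`j ↦ radialForm (-f(· + ja))` grows at the rate `-L (∑ c i)² ≤ 0`, so it decreases. -/
lemma IsRadialCPD.increment (hf : IsRadialCPD fun u => -f u) (hf0 : ∀ u, 0 ≤ u → 0 ≤ f u)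
    {a : ℝ} (ha : 0 < a) : IsRadialPD fun u => f (u + a) + -1 * f u := fun ι κ _ _ x c => by
  obtain ⟨L, hL0, hL⟩ := hf.exists_rate hf0 ha
  have hlim : Tendsto (fun m : ℕ => radialForm (fun u => -f (u + m * a)) x c / m) atTop
      (𝓝 (∑ i, ∑ j, c i * c j * -L)) := by
    simp only [radialForm, Finset.sum_div, mul_div_assoc, neg_div]
    exact tendsto_finsetSum _ fun i _ => tendsto_finsetSum _ fun j _ =>
      ((hL _ (Finset.sum_nonneg fun k _ => sq_nonneg _)).neg).const_mul _
  have := le_of_convex_seq (radialForm_convex ha.le (hf.second_diff ha.le) x c)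
    (fun _ => le_rfl) hlim (by
      have : ∑ i, ∑ j, c i * c j * -L = -(L * (∑ i, c i) ^ 2) := by
        rw [sq, Finset.sum_mul_sum, Finset.mul_sum, ← Finset.sum_neg_distrib]
        refine Finset.sum_congr rfl fun i _ => ?_
        rw [Finset.mul_sum, ← Finset.sum_neg_distrib]
        exact Finset.sum_congr rfl fun j _ => by ring
      rw [this]
      exact neg_nonpos.2 (mul_nonneg hL0 (sq_nonneg _)))
  have e : ∀ g : ℝ → ℝ, radialForm (fun u => -g u) x c = -radialForm g x c := fun g => by
    simpa using radialForm_const_mul g x c (-1)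
  rw [e, e] at this
  rw [radialForm_add, radialForm_const_mul]
  simp only [Nat.cast_one, one_mul, Nat.cast_zero, zero_mul, add_zero] at this
  linarith

lemma isRadialCPD_of_isContinuousNegativeDefinite
    (h : ∀ n : ℕ, IsContinuousNegativeDefinite (radialSymbol f (1 + 2 * n))) :
    IsRadialCPD fun u => -f u := fun ι κ _ _ x c hc => by
  classical
  -- the points are moved to a space of odd dimension, isometrically
  set n := Fintype.card κ
  let e : κ → Fin (1 + 2 * n) := fun k => Fin.castLE (by omega) (Fintype.equivFin κ k)
  have he : Function.Injective e := (Fin.castLE_injective _).comp (Fintype.equivFin κ).injective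
  let ξ : ι → Rk (1 + 2 * n) := fun i => WithLp.toLp 2 (Function.extend e (x i) 0)
  have hξ : ∀ i j, ‖ξ i - ξ j‖ ^ 2 = ∑ k, (x i k - x j k) ^ 2 := by
    intro i j
    rw [EuclideanSpace.real_norm_sq_eq]
    have h1 : ∀ k ∈ Finset.univ, k ∉ Finset.univ.image e → (ξ i - ξ j) k ^ 2 = 0 := by
      intro k _ hk
      have : ¬ ∃ a, e a = k := by simpa using hk
      simp [ξ, Function.extend_apply' _ _ _ this]
    rw [← Finset.sum_subset (Finset.subset_univ (Finset.univ.image e)) h1,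
      Finset.sum_image (fun a _ b _ hab => he hab)]
    exact Finset.sum_congr rfl fun k _ => by simp [ξ, he.extend_apply]
  have hM := (h n).2.2 (Fintype.card ι) (fun i => ξ ((Fintype.equivFin ι).symm i))
  have hM' := (hM.submatrix (Fintype.equivFin ι)).dotProduct_mulVec_nonneg (fun i => (c i : ℂ))
  have hre := (Complex.le_def.1 hM').1
  simp only [dotProduct, Matrix.mulVec, Matrix.submatrix_apply, Matrix.of_apply, radialSymbol,
    Equiv.symm_apply_apply, Pi.star_apply, RCLike.star_def, Complex.conj_ofReal] at hre
  have hre' : 0 ≤ ∑ i, c i * ∑ j, (f (‖ξ i‖ ^ 2) + f (‖ξ j‖ ^ 2) -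
      f (‖ξ i - ξ j‖ ^ 2)) * c j := by
    exact_mod_cast hre
  have hsplit : ∑ i, c i * ∑ j, (f (‖ξ i‖ ^ 2) + f (‖ξ j‖ ^ 2) - f (‖ξ i - ξ j‖ ^ 2)) * c j =
      (∑ i, c i * f (‖ξ i‖ ^ 2)) * ∑ j, c j + (∑ i, c i) * (∑ j, c j * f (‖ξ j‖ ^ 2)) +
        radialForm (fun u => -f u) x c := by
    rw [Finset.sum_mul_sum, Finset.sum_mul_sum]
    simp only [radialForm, hξ, ← Finset.sum_add_distrib, Finset.mul_sum]
    exact Finset.sum_congr rfl fun i _ => Finset.sum_congr rfl fun j _ => by ring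
  rw [hsplit, hc, mul_zero, zero_mul, zero_add, zero_add] at hre'
  exact hre'

theorem isDiffBernstein_of_isContinuousNegativeDefinite (hf0 : ∀ u, 0 ≤ u → 0 ≤ f u)
    (h : ∀ n : ℕ, IsContinuousNegativeDefinite (radialSymbol f (1 + 2 * n))) :
    IsDiffBernstein f := by
  have hCPD := isRadialCPD_of_isContinuousNegativeDefinite h
  refine ⟨?_, ?_, fun a ha n => ?_⟩
  · have := (h 0).2.1
    simpa [radialSymbol] using this
  · let e : Rk (1 + 2 * 0) := EuclideanSpace.single 0 1
    have h1 : Continuous fun r : ℝ => (radialSymbol f (1 + 2 * 0) (r • e)).re :=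
      Complex.continuous_re.comp ((h 0).1.comp (continuous_id.smul continuous_const))
    have h2 : Continuous fun u : ℝ => f (√u ^ 2) := by
      have := h1.comp Real.continuous_sqrt
      refine this.congr fun u => ?_
      simp [radialSymbol, norm_smul, e]
    exact h2.continuousOn.congr fun u hu => by
      simp only [Real.sq_sqrt hu]
  · rcases ha.eq_or_lt with rfl | ha
    · simpa using DiffMonotone.const le_rfl n
    · exact ((hCPD.increment hf0 ha).isDiffCM n).congr fun u _ => by ring

end

/-! ### Mixtures of Gaussian densities -/

/-- The radial profile of the density of the normal law with covariance `2s` on `ℝᵏ`. -/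
noncomputable def heatKernel (k : ℕ) (s r : ℝ) : ℝ :=
  (4 * Real.pi * s) ^ (-(k : ℝ) / 2) * Real.exp (-(r ^ 2 / (4 * s)))

/-- The mixture of the profiles `heatKernel k s` over `s > 0` with respect to `ρ`. Its value at
`r = 0` is `0` if the integral diverges there. -/
noncomputable def gaussMix (k : ℕ) (ρ : Measure ℝ) (r : ℝ) : ℝ :=
  ∫ s in Ioi 0, heatKernel k s r ∂ρ

lemma heatKernel_nonneg (k : ℕ) {s : ℝ} (hs : 0 ≤ s) (r : ℝ) : 0 ≤ heatKernel k s r := by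
  unfold heatKernel; positivity

@[fun_prop]
lemma measurable_heatKernel (k : ℕ) : Measurable fun p : ℝ × ℝ => heatKernel k p.1 p.2 := by
  unfold heatKernel; fun_prop

lemma pow_mul_exp_neg_le (n : ℕ) {c y : ℝ} (hc : 0 < c) (hy : 0 ≤ y) :
    y ^ n * Real.exp (-(c * y)) ≤ n.factorial / c ^ n := by
  have h := Real.pow_div_factorial_le_exp (c * y) (by positivity) n
  rw [Real.exp_neg, ← div_eq_mul_inv, div_le_div_iff₀ (Real.exp_pos _) (by positivity)]
  rw [div_le_iff₀ (by positivity), mul_pow] at h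
  linarith

lemma exists_heatKernel_le (k : ℕ) {r : ℝ} (hr : 0 < r) :
    ∃ C, ∀ s, 0 < s → heatKernel k s r ≤ C * min 1 s := by
  set c := r ^ 2 / 4
  have hc : 0 < c := by positivity
  set A : ℝ := 1 + k.factorial / c ^ k
  set B : ℝ := (1 : ℕ).factorial / c ^ 1 + (k + 1).factorial / c ^ (k + 1)
  have hA : 0 ≤ A := by positivity
  have hB : 0 ≤ B := by positivity
  refine ⟨A + B, fun s hs => ?_⟩
  set y := s⁻¹ with hy
  have hy0 : 0 < y := inv_pos.2 hs
  have hK : heatKernel k s r ≤ (1 + y ^ k) * Real.exp (-(c * y)) := by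
    have e : r ^ 2 / (4 * s) = c * y := by simp only [c, hy]; field_simp
    rw [heatKernel, e]
    gcongr
    rw [neg_div, Real.rpow_neg (by positivity), ← Real.inv_rpow (by positivity)]
    have h1 : (4 * Real.pi * s)⁻¹ ≤ y := by
      rw [hy]
      refine inv_anti₀ hs ?_
      nlinarith [Real.pi_gt_three]
    refine (Real.rpow_le_rpow (by positivity) h1 (by positivity)).trans ?_
    rcases le_total y 1 with h | h
    · exact (Real.rpow_le_one hy0.le h (by positivity)).trans (by linarith [pow_pos hy0 k])
    · refine (Real.rpow_le_rpow_of_exponent_le h (y := (k : ℝ) / 2) (z := k) ?_).trans ?_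
      · have : (0 : ℝ) ≤ k := by positivity
        linarith
      · rw [Real.rpow_natCast]; linarith
  have he : Real.exp (-(c * y)) ≤ 1 := Real.exp_le_one_iff.2 (by
    have := mul_pos hc hy0; linarith)
  have h1 : heatKernel k s r ≤ A := by
    refine hK.trans ?_
    rw [add_mul, one_mul]
    exact add_le_add he (pow_mul_exp_neg_le k hc hy0.le)
  have h2 : heatKernel k s r ≤ B * s := by
    have h3 := pow_mul_exp_neg_le 1 hc hy0.le
    have h4 := pow_mul_exp_neg_le (k + 1) hc hy0.le
    have : (1 + y ^ k) * Real.exp (-(c * y)) =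
        (y ^ 1 * Real.exp (-(c * y)) + y ^ (k + 1) * Real.exp (-(c * y))) * s := by
      have hys : y * s = 1 := inv_mul_cancel₀ hs.ne'
      rw [pow_one]
      linear_combination -(1 + y ^ k) * Real.exp (-(c * y)) * hys
    refine hK.trans ?_
    rw [this]
    gcongr
    exact add_le_add h3 h4
  rcases le_total 1 s with h | h
  · rw [min_eq_left h]; linarith
  · rw [min_eq_right h]; nlinarith

section
variable {ρ : Measure ℝ}

lemma integrableOn_heatKernel (k : ℕ) (hρ : ∫⁻ y in Ioi 0, ENNReal.ofReal (min 1 y) ∂ρ < ∞)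
    {r : ℝ} (hr : 0 < r) : IntegrableOn (fun s => heatKernel k s r) (Ioi 0) ρ := by
  obtain ⟨C, hC⟩ := exists_heatKernel_le k hr
  refine ((integrableOn_min_one hρ).const_mul C).mono' ?_ ?_
  · exact (by fun_prop : Measurable fun s => heatKernel k s r).aestronglyMeasurable
  · filter_upwards [ae_restrict_mem measurableSet_Ioi] with s hs
    rw [Real.norm_of_nonneg (heatKernel_nonneg k (le_of_lt hs) r)]
    exact hC s hs

lemma gaussMix_nonneg (k : ℕ) (r : ℝ) : 0 ≤ gaussMix k ρ r :=
  setIntegral_nonneg measurableSet_Ioi fun _ hs => heatKernel_nonneg k (le_of_lt hs) r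

/-- The measure `(4πs)^{-k/2} ρ(ds)` on `(0,∞)`. As a function of `r²`, the mixture is the Laplace
transform of its image under `s ↦ 1/(4s)`. -/
noncomputable def mixingMeasure (k : ℕ) (ρ : Measure ℝ) : Measure ℝ :=
  (ρ.restrict (Ioi 0)).withDensity fun s => ENNReal.ofReal ((4 * Real.pi * s) ^ (-(k : ℝ) / 2))

lemma integral_mixingMeasure (k : ℕ) (g : ℝ → ℝ) :
    ∫ s, g s ∂mixingMeasure k ρ = ∫ s in Ioi 0, (4 * Real.pi * s) ^ (-(k : ℝ) / 2) * g s ∂ρ := by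
  rw [mixingMeasure, integral_withDensity_eq_integral_toReal_smul (by fun_prop)
    (.of_forall fun _ => ENNReal.ofReal_lt_top)]
  refine setIntegral_congr_fun measurableSet_Ioi fun s hs => ?_
  have : (0 : ℝ) < s := hs
  simp only [smul_eq_mul]
  rw [ENNReal.toReal_ofReal (by positivity)]

lemma gaussMix_eq_mgf (k : ℕ) (r : ℝ) :
    gaussMix k ρ r = mgf (fun s => -(1 / (4 * s))) (mixingMeasure k ρ) (r ^ 2) := by
  rw [mgf, integral_mixingMeasure, gaussMix]
  congr 1 with s
  rw [heatKernel]
  ring_nf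

lemma mem_interior_integrableExpSet (k : ℕ)
    (hρ : ∫⁻ y in Ioi 0, ENNReal.ofReal (min 1 y) ∂ρ < ∞) {x : ℝ} (hx : 0 < x) :
    x ∈ interior (integrableExpSet (fun s : ℝ => -(1 / (4 * s))) (mixingMeasure k ρ)) := by
  refine interior_maximal (s := integrableExpSet (fun s : ℝ => -(1 / (4 * s)))
    (mixingMeasure k ρ)) (t := Ioi 0) (fun x (hx : 0 < x) => ?_) isOpen_Ioi hx
  rw [integrableExpSet, mem_ofPred_eq, mixingMeasure, integrable_withDensity_iff_integrable_smul'
    (by fun_prop) (.of_forall fun _ => ENNReal.ofReal_lt_top)]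
  refine (integrableOn_heatKernel k hρ (Real.sqrt_pos.2 hx)).congr ?_
  filter_upwards [ae_restrict_mem measurableSet_Ioi] with s hs
  have : (0 : ℝ) < s := hs
  rw [ENNReal.toReal_ofReal (by positivity), heatKernel, Real.sq_sqrt hx.le, smul_eq_mul]
  ring_nf

theorem isCMProfile_gaussMix (k : ℕ) (hρ : ∫⁻ y in Ioi 0, ENNReal.ofReal (min 1 y) ∂ρ < ∞) :
    IsCMProfile (gaussMix k ρ) := by
  set X : ℝ → ℝ := fun s => -(1 / (4 * s))
  have heq : EqOn (fun r => gaussMix k ρ (√r)) (mgf X (mixingMeasure k ρ)) (Ioi 0) := fun r hr => by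
    simp only [gaussMix_eq_mgf]
    rw [Real.sq_sqrt (le_of_lt hr)]
  refine ⟨fun r _ => gaussMix_nonneg k r, ContDiffOn.congr ?_ heq, fun n r hr => ?_⟩
  · exact (analyticOnNhd_mgf.mono fun x hx =>
      mem_interior_integrableExpSet k hρ hx).contDiffOn (uniqueDiffOn_Ioi 0)
  · rw [(heq.eventuallyEq_of_mem (Ioi_mem_nhds hr)).iteratedDeriv_eq n,
      iteratedDeriv_mgf (mem_interior_integrableExpSet k hρ hr), integral_mixingMeasure,
      ← integral_const_mul]
    refine setIntegral_nonneg measurableSet_Ioi fun s hs => ?_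
    have : (0 : ℝ) < s := hs
    have e : (-1) ^ n * ((4 * Real.pi * s) ^ (-(k : ℝ) / 2) * (X s ^ n * Real.exp (r * X s))) =
        (4 * Real.pi * s) ^ (-(k : ℝ) / 2) * ((1 / (4 * s)) ^ n * Real.exp (r * X s)) := by
      have h1 : (-1 : ℝ) ^ n * X s ^ n = (1 / (4 * s)) ^ n := by
        rw [← mul_pow]; simp [X]
      rw [← h1]; ring
    rw [e]; positivity

/-- Differentiation in `r` produces the factor `-r/(2s) = -2πr (4πs)⁻¹`, which raises the
dimension by `2`. -/
theorem hasDerivAt_gaussMix (k : ℕ) (hρ : ∫⁻ y in Ioi 0, ENNReal.ofReal (min 1 y) ∂ρ < ∞) {r : ℝ}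
    (hr : 0 < r) : HasDerivAt (gaussMix k ρ) (-(2 * Real.pi * r) * gaussMix (k + 2) ρ r) r := by
  have h1 := (hasDerivAt_mgf (mem_interior_integrableExpSet k hρ (x := r ^ 2) (by positivity)))
  have h2 := HasDerivAt.comp (h := fun x : ℝ => x ^ 2) r h1 (hasDerivAt_pow 2 r)
  have e : gaussMix k ρ = (mgf (fun s => -(1 / (4 * s))) (mixingMeasure k ρ)) ∘ fun x => x ^ 2 :=
    funext fun r => gaussMix_eq_mgf k r
  rw [e]
  refine h2.congr_deriv (Eq.symm ?_)
  rw [integral_mixingMeasure, gaussMix, ← integral_const_mul, ← integral_mul_const]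
  refine setIntegral_congr_fun measurableSet_Ioi fun s hs => ?_
  have hs' : (0 : ℝ) < s := hs
  have hp : (4 * Real.pi * s) ^ (-((k + 2 : ℕ) : ℝ) / 2) =
      (4 * Real.pi * s) ^ (-(k : ℝ) / 2) * (4 * Real.pi * s)⁻¹ := by
    rw [← Real.rpow_neg_one (4 * Real.pi * s), ← Real.rpow_add (by positivity)]
    congr 1; push_cast; ring
  have hexp : r ^ 2 * -(1 / (4 * s)) = -(r ^ 2 / (4 * s)) := by ring
  simp only [heatKernel, hp, hexp]
  field_simp
  ring

end

/-! ### Fourier transforms of Gaussian mixtures -/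

lemma integral_exp_mul_cexp (k : ℕ) {b : ℝ} (hb : 0 < b) (ξ : Rk k) :
    ∫ x : Rk k, (Real.exp (-(b * ‖x‖ ^ 2)) : ℂ) * Complex.exp ((inner ℝ x ξ : ℝ) * Complex.I) =
      (((Real.pi / b) ^ ((k : ℝ) / 2) * Real.exp (-(‖ξ‖ ^ 2 * (1 / (4 * b)))) : ℝ) : ℂ) := by
  have h := GaussianFourier.integral_cexp_neg_mul_sq_norm_add (b := (b : ℂ)) (by simpa using hb)
    Complex.I ξ
  rw [finrank_euclideanSpace_fin] at h
  convert h using 1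
  · congr 1 with x
    rw [Complex.ofReal_exp, ← Complex.exp_add, real_inner_comm]
    congr 1; push_cast; ring
  · push_cast
    rw [Complex.ofReal_cpow (by positivity)]
    push_cast
    rw [Complex.I_sq]
    congr 2; ring

lemma integrable_exp_neg_mul_sq_norm (k : ℕ) {b : ℝ} (hb : 0 < b) :
    Integrable fun x : Rk k => Real.exp (-(b * ‖x‖ ^ 2)) := by
  by_contra h
  have h1 := GaussianFourier.integral_rexp_neg_mul_sq_norm (V := Rk k) hb
  simp only [neg_mul] at h1
  rw [integral_undef h] at h1
  have : (0 : ℝ) < (Real.pi / b) ^ (Module.finrank ℝ (Rk k) / 2 : ℝ) := by positivity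
  linarith

lemma heatKernel_eq (k : ℕ) (s r : ℝ) :
    heatKernel k s r = (4 * Real.pi * s) ^ (-(k : ℝ) / 2) * Real.exp (-(1 / (4 * s) * r ^ 2)) := by
  rw [heatKernel]; ring_nf

lemma integrable_heatKernel (k : ℕ) {s : ℝ} (hs : 0 < s) :
    Integrable fun x : Rk k => heatKernel k s ‖x‖ := by
  simp only [heatKernel_eq]
  exact (integrable_exp_neg_mul_sq_norm k (by positivity)).const_mul _

lemma integral_heatKernel_mul_cexp (k : ℕ) {s : ℝ} (hs : 0 < s) (ξ : Rk k) :
    ∫ x : Rk k, (heatKernel k s ‖x‖ : ℂ) * Complex.exp ((inner ℝ x ξ : ℝ) * Complex.I) =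
      (Real.exp (-(‖ξ‖ ^ 2 * s)) : ℂ) := by
  simp only [heatKernel_eq, Complex.ofReal_mul, mul_assoc (Complex.ofReal _)]
  have := integral_exp_mul_cexp k (b := 1 / (4 * s)) (by positivity) ξ
  rw [integral_const_mul, this, ← Complex.ofReal_mul, ← mul_assoc]
  have e1 : Real.pi / (1 / (4 * s)) = 4 * Real.pi * s := by field_simp
  have e2 : 1 / (4 * (1 / (4 * s))) = s := by field_simp
  rw [e1, e2, ← Real.rpow_add (by positivity), neg_div, neg_add_cancel, Real.rpow_zero, one_mul]

lemma integral_heatKernel (k : ℕ) {s : ℝ} (hs : 0 < s) :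
    ∫ x : Rk k, heatKernel k s ‖x‖ = 1 := by
  have := integral_heatKernel_mul_cexp k hs 0
  simp only [inner_zero_right, Complex.ofReal_zero, zero_mul, Complex.exp_zero, mul_one,
    norm_zero, ne_eq, OfNat.ofNat_ne_zero, not_false_eq_true, zero_pow, neg_zero,
    Real.exp_zero] at this
  rw [integral_complex_ofReal] at this
  exact_mod_cast this

/-- The truncated second moment of the Gaussian law: `|y|² e^{-|y|²/4s} ≤ 8s e^{-|y|²/8s}` compares
it with the Gaussian law for the parameter `2s`. -/
lemma integral_min_mul_heatKernel_le (k : ℕ) {s : ℝ} (hs : 0 < s) :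
    ∫ x : Rk k, min 1 (‖x‖ ^ 2) * heatKernel k s ‖x‖ ≤ 8 * 2 ^ ((k : ℝ) / 2) * min 1 s := by
  have hi : Integrable fun x : Rk k => min 1 (‖x‖ ^ 2) * heatKernel k s ‖x‖ :=
    (integrable_heatKernel k hs).bdd_mul (c := 1) (by fun_prop) (.of_forall fun x => by
      rw [Real.norm_of_nonneg (by positivity)]; exact min_le_left _ _)
  have h2 : (1 : ℝ) ≤ 2 ^ ((k : ℝ) / 2) := Real.one_le_rpow (by norm_num) (by positivity)
  have hb1 : ∫ x : Rk k, min 1 (‖x‖ ^ 2) * heatKernel k s ‖x‖ ≤ 1 := by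
    refine le_of_le_of_eq ?_ (integral_heatKernel k hs)
    refine integral_mono hi (integrable_heatKernel k hs) fun x => ?_
    exact mul_le_of_le_one_left (heatKernel_nonneg k hs.le _) (min_le_left _ _)
  have hb2 : ∫ x : Rk k, min 1 (‖x‖ ^ 2) * heatKernel k s ‖x‖ ≤ 8 * 2 ^ ((k : ℝ) / 2) * s := by
    have : 8 * 2 ^ ((k : ℝ) / 2) * s =
        ∫ x : Rk k, 8 * 2 ^ ((k : ℝ) / 2) * s * heatKernel k (2 * s) ‖x‖ := by
      rw [integral_const_mul, integral_heatKernel k (by positivity), mul_one]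
    rw [this]
    refine integral_mono hi ((integrable_heatKernel k (by positivity)).const_mul _) fun x => ?_
    have e1 : (4 * Real.pi * s) ^ (-(k : ℝ) / 2) =
        2 ^ ((k : ℝ) / 2) * (4 * Real.pi * (2 * s)) ^ (-(k : ℝ) / 2) := by
      have : 4 * Real.pi * (2 * s) = 2 * (4 * Real.pi * s) := by ring
      rw [this, Real.mul_rpow (x := 2) (by norm_num) (by positivity), ← mul_assoc,
        ← Real.rpow_add (by norm_num), neg_div, add_neg_cancel, Real.rpow_zero, one_mul]
    set z := ‖x‖ ^ 2 / (4 * (2 * s)) with hz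
    have e2 : ‖x‖ ^ 2 / (4 * s) = z + z := by rw [hz]; field_simp; ring
    have e3 : ‖x‖ ^ 2 = 8 * s * z := by rw [hz]; field_simp; ring
    have hz0 : 0 ≤ z := by positivity
    have hz1 : z * Real.exp (-z) ≤ 1 := by
      have := pow_mul_exp_neg_le 1 one_pos hz0
      simpa using this
    simp only [heatKernel, e1, e2, neg_add, Real.exp_add]
    calc _ ≤ ‖x‖ ^ 2 * (2 ^ ((k : ℝ) / 2) * (4 * Real.pi * (2 * s)) ^ (-(k : ℝ) / 2) *
          (Real.exp (-z) * Real.exp (-z))) := by gcongr; exact min_le_right _ _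
      _ = 8 * s * 2 ^ ((k : ℝ) / 2) * (4 * Real.pi * (2 * s)) ^ (-(k : ℝ) / 2) *
          Real.exp (-z) * (z * Real.exp (-z)) := by rw [e3]; ring
      _ ≤ 8 * s * 2 ^ ((k : ℝ) / 2) * (4 * Real.pi * (2 * s)) ^ (-(k : ℝ) / 2) *
          Real.exp (-z) * 1 := by gcongr
      _ = _ := by ring
  rcases le_total 1 s with h | h
  · rw [min_eq_left h]; linarith
  · rw [min_eq_right h]; exact hb2

/-! ### Transition laws and Lévy measures as Gaussian mixtures -/

/-- A measure that integrates `min 1 y` over `(0,∞)` has a positive density with respect to a finite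
measure there. -/
lemma sFinite_restrict_Ioi {ρ : Measure ℝ} (hρ : ∫⁻ y in Ioi 0, ENNReal.ofReal (min 1 y) ∂ρ < ∞) :
    SFinite (ρ.restrict (Ioi 0)) := by
  have hm : Measurable fun y : ℝ => ENNReal.ofReal (min 1 y) := by fun_prop
  have : IsFiniteMeasure ((ρ.restrict (Ioi 0)).withDensity fun y => ENNReal.ofReal (min 1 y)) :=
    isFiniteMeasure_withDensity hρ.ne
  rw [← withDensity_inv_same (μ := ρ.restrict (Ioi 0)) hm ?_
    (.of_forall fun _ => ENNReal.ofReal_ne_top)]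
  · infer_instance
  · filter_upwards [ae_restrict_mem measurableSet_Ioi] with y hy
    have : (0 : ℝ) < y := hy
    simpa using this

lemma lintegral_min_one_lt_top (η : Measure ℝ) [IsFiniteMeasure η] :
    ∫⁻ y in Ioi 0, ENNReal.ofReal (min 1 y) ∂η < ∞ := by
  refine (setLIntegral_mono (g := fun _ => 1) (by fun_prop) fun y _ => ?_).trans_lt ?_
  · rw [← ENNReal.ofReal_one]
    exact ENNReal.ofReal_le_ofReal (min_le_left _ _)
  · simp

section
variable {k : ℕ} {ρ : Measure ℝ}

lemma ae_ne_zero (hk : 1 ≤ k) : ∀ᵐ x : Rk k, x ≠ 0 := by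
  have : Nonempty (Fin k) := ⟨⟨0, hk⟩⟩
  simp [ae_iff]

lemma measurable_gaussMix [SFinite (ρ.restrict (Ioi 0))] : Measurable (gaussMix k ρ) := by
  have h : Measurable fun p : ℝ × ℝ => heatKernel k p.2 p.1 := by unfold heatKernel; fun_prop
  exact (h.stronglyMeasurable.integral_prod_right' (ν := ρ.restrict (Ioi 0))).measurable

lemma integrable_heatKernel_prod [SFinite (ρ.restrict (Ioi 0))] {W : Rk k → ℂ} (hW : Measurable W)
    {D : Rk k → ℝ} (hWD : ∀ x, ‖W x‖ ≤ D x)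
    (hD : ∀ s, 0 < s → Integrable fun x : Rk k => D x * heatKernel k s ‖x‖) {B : ℝ → ℝ}
    (hB : ∀ s, 0 < s → ∫ x : Rk k, D x * heatKernel k s ‖x‖ ≤ B s)
    (hBi : IntegrableOn B (Ioi 0) ρ) :
    Integrable (fun p : ℝ × Rk k => (heatKernel k p.1 ‖p.2‖ : ℂ) * W p.2)
      ((ρ.restrict (Ioi 0)).prod volume) := by
  have hm : Measurable fun p : ℝ × Rk k => (heatKernel k p.1 ‖p.2‖ : ℂ) * W p.2 := by fun_prop
  have hle : ∀ s : ℝ, 0 < s → ∀ x : Rk k,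
      ‖(heatKernel k s ‖x‖ : ℂ) * W x‖ ≤ D x * heatKernel k s ‖x‖ := fun s hs x => by
    have h0 := heatKernel_nonneg k hs.le ‖x‖
    rw [norm_mul, Complex.norm_real, Real.norm_of_nonneg h0, mul_comm]
    gcongr
    exact hWD x
  have hi : ∀ s : ℝ, 0 < s → Integrable fun x : Rk k => (heatKernel k s ‖x‖ : ℂ) * W x :=
    fun s hs => (hD s hs).mono' (hm.comp measurable_prodMk_left).aestronglyMeasurable
      (.of_forall (hle s hs))
  rw [integrable_prod_iff hm.aestronglyMeasurable]
  refine ⟨?_, hBi.mono' hm.aestronglyMeasurable.norm.integral_prod_right' ?_⟩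
  · filter_upwards [ae_restrict_mem measurableSet_Ioi] with s hs using hi s hs
  · filter_upwards [ae_restrict_mem measurableSet_Ioi] with s hs
    rw [Real.norm_of_nonneg (integral_nonneg fun x => norm_nonneg _)]
    exact (integral_mono (hi s hs).norm (hD s hs) (hle s hs)).trans (hB s hs)

lemma integrable_gaussMix_mul {W : Rk k → ℂ}
    (hW : Integrable (fun p : ℝ × Rk k => (heatKernel k p.1 ‖p.2‖ : ℂ) * W p.2)
      ((ρ.restrict (Ioi 0)).prod volume)) [SFinite (ρ.restrict (Ioi 0))] :
    Integrable fun x : Rk k => (gaussMix k ρ ‖x‖ : ℂ) * W x := by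
  refine hW.integral_prod_right.congr (.of_forall fun x => ?_)
  simp only [gaussMix]
  rw [integral_mul_const, integral_complex_ofReal]

/-- Integration against the density `gaussMix k ρ` is integration against the Gaussian laws first,
and against `ρ` afterwards. -/
theorem integral_radialMeasure_gaussMix [SFinite (ρ.restrict (Ioi 0))] {W : Rk k → ℂ}
    (hW : Integrable (fun p : ℝ × Rk k => (heatKernel k p.1 ‖p.2‖ : ℂ) * W p.2)
      ((ρ.restrict (Ioi 0)).prod volume)) :
    ∫ x, W x ∂radialMeasure k (gaussMix k ρ) =
      ∫ s in Ioi 0, (∫ x : Rk k, (heatKernel k s ‖x‖ : ℂ) * W x) ∂ρ := by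
  have hm : Measurable fun x : Rk k => ENNReal.ofReal (gaussMix k ρ ‖x‖) :=
    (measurable_gaussMix.comp measurable_norm).ennreal_ofReal
  rw [radialMeasure, integral_withDensity_eq_integral_toReal_smul hm
    (.of_forall fun _ => ENNReal.ofReal_lt_top), integral_integral_swap hW]
  congr 1 with x
  rw [ENNReal.toReal_ofReal (gaussMix_nonneg k _), Complex.real_smul, integral_mul_const,
    integral_complex_ofReal, gaussMix]

lemma integrable_heatKernel_prod_of_bounded {η : Measure ℝ} [IsFiniteMeasure η] {W : Rk k → ℂ}
    (hW : Measurable W) (hW1 : ∀ x, ‖W x‖ ≤ 1) :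
    Integrable (fun p : ℝ × Rk k => (heatKernel k p.1 ‖p.2‖ : ℂ) * W p.2)
      ((η.restrict (Ioi 0)).prod volume) :=
  integrable_heatKernel_prod hW hW1 (B := fun _ => 1)
    (fun s hs => by simpa using integrable_heatKernel k hs)
    (fun s hs => by simpa using (integral_heatKernel k hs).le) (by simp)

lemma integrable_heatKernel_prod_of_le_min (hρ : ∫⁻ y in Ioi 0, ENNReal.ofReal (min 1 y) ∂ρ < ∞)
    {W : Rk k → ℂ} (hW : Measurable W) {C : ℝ} (hWC : ∀ x, ‖W x‖ ≤ C * min 1 (‖x‖ ^ 2))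
    (hC : 0 ≤ C) :
    Integrable (fun p : ℝ × Rk k => (heatKernel k p.1 ‖p.2‖ : ℂ) * W p.2)
      ((ρ.restrict (Ioi 0)).prod volume) := by
  have := sFinite_restrict_Ioi hρ
  refine integrable_heatKernel_prod hW hWC
    (B := fun s => C * (8 * 2 ^ ((k : ℝ) / 2) * min 1 s)) (fun s hs => ?_) (fun s hs => ?_)
    (((integrableOn_min_one hρ).const_mul _).const_mul _)
  · refine (integrable_heatKernel k hs).bdd_mul (c := C) (by fun_prop) (.of_forall fun x => ?_)
    rw [Real.norm_of_nonneg (by positivity)]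
    exact mul_le_of_le_one_right hC (min_le_left _ _)
  · simp only [mul_assoc C]
    rw [integral_const_mul]
    gcongr
    exact integral_min_mul_heatKernel_le k hs

lemma isFiniteMeasure_radialMeasure_gaussMix {η : Measure ℝ} [IsFiniteMeasure η] :
    IsFiniteMeasure (radialMeasure k (gaussMix k η)) := by
  let W : Rk k → ℂ := fun _ => 1
  have h := integrable_gaussMix_mul (integrable_heatKernel_prod_of_bounded (η := η) (W := W)
    (by fun_prop) (by simp [W]))
  refine isFiniteMeasure_withDensity ?_
  have h2 := h.re.lintegral_lt_top
  simpa [W] using h2.ne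

/-- The law with density `p(|x|)`, `p = gaussMix k η`, and an atom of mass `η {0}` at the origin is
the normal law with covariance `2s` randomized by `η(ds)`. -/
theorem charFun_radialLaw_gaussMix {η : Measure ℝ} [IsFiniteMeasure η] (hη : η (Iio 0) = 0)
    {c : ℝ≥0∞} {t : ℝ≥0} (hc : EReal.exp (-((c * t : ℝ≥0∞) : EReal)) = η {0}) (ξ : Rk k) :
    charFun (radialLaw k c t (gaussMix k η)) ξ =
      ((∫ s, Real.exp (-(‖ξ‖ ^ 2 * s)) ∂η : ℝ) : ℂ) := by
  have hb : ∀ x : Rk k, ‖Complex.exp ((inner ℝ x ξ : ℝ) * Complex.I)‖ ≤ 1 := fun x => by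
    rw [Complex.norm_exp_ofReal_mul_I]
  have hm : Measurable fun x : Rk k => Complex.exp ((inner ℝ x ξ : ℝ) * Complex.I) := by fun_prop
  have : IsFiniteMeasure (radialMeasure k (gaussMix k η)) := isFiniteMeasure_radialMeasure_gaussMix
  rw [charFun_apply, radialLaw, hc, integral_add_measure, integral_smul_measure, integral_dirac,
    integral_radialMeasure_gaussMix (integrable_heatKernel_prod_of_bounded hm hb),
    integral_eq_zero_add_Ioi hη (integrable_exp_neg_mul hη (by positivity))]
  · push_cast
    congr 1
    · simp [Measure.real]
    · rw [← integral_complex_ofReal]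
      exact setIntegral_congr_fun measurableSet_Ioi fun s (hs : 0 < s) =>
        integral_heatKernel_mul_cexp k hs ξ
  · exact (integrable_dirac (by simp)).smul_measure (measure_ne_top η _)
  · exact (integrable_const (1 : ℝ)).mono' hm.aestronglyMeasurable (.of_forall hb)

end

/-! ### The Lévy–Khintchine representation -/

section
variable {k : ℕ}

/-- The integrand of the Lévy–Khintchine formula. -/
noncomputable def levyIntegrand (ξ y : Rk k) : ℂ :=
  1 - Complex.exp (Complex.I * (inner ℝ y ξ : ℝ)) +
    (Metric.ball (0 : Rk k) 1).indicator (fun z => Complex.I * (inner ℝ z ξ : ℝ)) y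

@[fun_prop]
lemma measurable_levyIntegrand (ξ : Rk k) : Measurable (levyIntegrand ξ) := by
  unfold levyIntegrand
  exact (by fun_prop : Measurable fun y : Rk k =>
    1 - Complex.exp (Complex.I * (inner ℝ y ξ : ℝ))).add
    ((by fun_prop : Measurable fun z : Rk k => Complex.I * (inner ℝ z ξ : ℝ)).indicator
      measurableSet_ball)

lemma norm_one_sub_exp_add_le (a : ℝ) :
    ‖1 - Complex.exp (Complex.I * a) + Complex.I * a‖ ≤ 3 * a ^ 2 := by
  rcases le_total |a| 1 with h | h
  · have h1 : ‖Complex.I * (a : ℂ)‖ = |a| := by simp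
    have h2 := Complex.norm_exp_sub_one_sub_id_le (x := Complex.I * a) (h1 ▸ h)
    rw [← norm_neg, h1, sq_abs] at h2
    have e : -(Complex.exp (Complex.I * a) - 1 - Complex.I * a) =
      1 - Complex.exp (Complex.I * a) + Complex.I * a := by ring
    rw [e] at h2
    nlinarith [sq_nonneg a]
  · refine (norm_add_le _ _).trans ((add_le_add_left (norm_sub_le _ _) _).trans ?_)
    rw [Complex.norm_exp_I_mul_ofReal]
    simp only [norm_one, norm_mul, Complex.norm_I, Complex.norm_real, Real.norm_eq_abs, one_mul]
    nlinarith [sq_abs a]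

lemma norm_levyIntegrand_le (ξ y : Rk k) :
    ‖levyIntegrand ξ y‖ ≤ (3 * ‖ξ‖ ^ 2 + 2) * min 1 (‖y‖ ^ 2) := by
  by_cases hy : y ∈ Metric.ball (0 : Rk k) 1
  · have hy1 : ‖y‖ < 1 := by simpa using hy
    rw [levyIntegrand, indicator_of_mem hy, min_eq_right (by nlinarith [norm_nonneg y])]
    refine (norm_one_sub_exp_add_le _).trans ?_
    have h1 : (inner ℝ y ξ : ℝ) ^ 2 ≤ ‖y‖ ^ 2 * ‖ξ‖ ^ 2 := by
      rw [← mul_pow, ← sq_abs]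
      gcongr
      exact abs_real_inner_le_norm y ξ
    nlinarith [sq_nonneg ‖y‖]
  · have hy1 : 1 ≤ ‖y‖ := by simpa using hy
    rw [levyIntegrand, indicator_of_notMem hy, add_zero, min_eq_left (by nlinarith)]
    refine (norm_sub_le _ _).trans ?_
    rw [Complex.norm_exp_I_mul_ofReal, norm_one]
    nlinarith [sq_nonneg ‖ξ‖]

/-- The compensator is odd, so it does not contribute. -/
lemma integral_heatKernel_mul_levyIntegrand {s : ℝ} (hs : 0 < s) (ξ : Rk k) :
    ∫ x : Rk k, (heatKernel k s ‖x‖ : ℂ) * levyIntegrand ξ x =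
      ((1 - Real.exp (-(‖ξ‖ ^ 2 * s)) : ℝ) : ℂ) := by
  have hk := integrable_heatKernel k hs
  have hkc : Integrable fun x : Rk k => (heatKernel k s ‖x‖ : ℂ) := hk.ofReal
  have h1 : Integrable fun x : Rk k =>
      (heatKernel k s ‖x‖ : ℂ) * Complex.exp ((inner ℝ x ξ : ℝ) * Complex.I) :=
    hkc.mul_bdd (c := 1) (by fun_prop)
      (.of_forall fun x => by rw [Complex.norm_exp_ofReal_mul_I])
  set T : Rk k → ℂ := fun x => (heatKernel k s ‖x‖ : ℂ) *
    (Metric.ball (0 : Rk k) 1).indicator (fun z => Complex.I * (inner ℝ z ξ : ℝ)) x with hT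
  have hTi : Integrable T := by
    refine hkc.mul_bdd (c := ‖ξ‖) ?_ (.of_forall fun x => ?_)
    · exact ((by fun_prop : Measurable fun z : Rk k => Complex.I * (inner ℝ z ξ : ℝ)).indicator
        measurableSet_ball).aestronglyMeasurable
    · by_cases hx : x ∈ Metric.ball (0 : Rk k) 1
      · have hx1 : ‖x‖ < 1 := by simpa using hx
        rw [indicator_of_mem hx, norm_mul, Complex.norm_I, one_mul, Complex.norm_real]
        refine (abs_real_inner_le_norm x ξ).trans ?_
        nlinarith [norm_nonneg ξ]
      · rw [indicator_of_notMem hx, norm_zero]; positivity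
  have hT0 : ∫ x, T x = 0 := by
    have hodd : ∀ x, T (-x) = -T x := fun x => by
      simp only [hT, norm_neg]
      by_cases hx : x ∈ Metric.ball (0 : Rk k) 1
      · have hx' : -x ∈ Metric.ball (0 : Rk k) 1 := by simpa using hx
        rw [indicator_of_mem hx, indicator_of_mem hx', inner_neg_left]
        push_cast; ring
      · have hx' : -x ∉ Metric.ball (0 : Rk k) 1 := by simpa using hx
        rw [indicator_of_notMem hx, indicator_of_notMem hx']
        simp
    have h2 := integral_neg_eq_self T (volume : Measure (Rk k))
    simp only [hodd, integral_neg] at h2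
    exact self_eq_neg.1 h2.symm
  have e : ∀ x : Rk k, (heatKernel k s ‖x‖ : ℂ) * levyIntegrand ξ x =
      (heatKernel k s ‖x‖ : ℂ) - (heatKernel k s ‖x‖ : ℂ) *
        Complex.exp ((inner ℝ x ξ : ℝ) * Complex.I) + T x := fun x => by
    rw [levyIntegrand, hT, mul_comm Complex.I]; ring
  simp only [e]
  rw [integral_add (by exact hkc.sub h1) hTi, integral_sub hkc h1, hT0,
    integral_heatKernel_mul_cexp k hs, integral_complex_ofReal, integral_heatKernel k hs]
  push_cast; ring

/-- If `α` and `μ` represent `f`, then `f(|ξ|²)` has the Lévy triplet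
`(0, 2α, gaussMix k μ (|x|) dx)`. -/
theorem levyKhintchineExponent_gaussMix {α : ℝ} {μ : Measure ℝ}
    (hμ : ∫⁻ y in Ioi 0, ENNReal.ofReal (min 1 y) ∂μ < ∞) (ξ : Rk k) :
    levyKhintchineExponent 0 ((2 * α) • 1) (radialMeasure k (gaussMix k μ)) ξ =
      ((α * ‖ξ‖ ^ 2 + ∫ y in Ioi 0, (1 - Real.exp (-(‖ξ‖ ^ 2 * y))) ∂μ : ℝ) : ℂ) := by
  have := sFinite_restrict_Ioi hμ
  have h1 : ∫ y, levyIntegrand ξ y ∂radialMeasure k (gaussMix k μ) =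
      ((∫ y in Ioi 0, (1 - Real.exp (-(‖ξ‖ ^ 2 * y))) ∂μ : ℝ) : ℂ) := by
    rw [integral_radialMeasure_gaussMix (integrable_heatKernel_prod_of_le_min hμ
      (measurable_levyIntegrand ξ) (norm_levyIntegrand_le ξ) (by positivity)),
      ← integral_complex_ofReal]
    exact setIntegral_congr_fun measurableSet_Ioi fun s (hs : 0 < s) =>
      integral_heatKernel_mul_levyIntegrand hs ξ
  have h2 : WithLp.ofLp ξ ⬝ᵥ ((2 * α) • (1 : Matrix (Fin k) (Fin k) ℝ)).mulVec (WithLp.ofLp ξ) =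
      2 * α * ‖ξ‖ ^ 2 := by
    rw [Matrix.smul_mulVec, Matrix.one_mulVec, dotProduct_smul, smul_eq_mul,
      EuclideanSpace.real_norm_sq_eq]
    congr 1
    exact Finset.sum_congr rfl fun i _ => (sq _).symm
  rw [levyKhintchineExponent, h2]
  simp only [← levyIntegrand.eq_1]
  rw [h1]
  simp
  ring

lemma lintegral_min_one_radialMeasure {μ : Measure ℝ}
    (hμ : ∫⁻ y in Ioi 0, ENNReal.ofReal (min 1 y) ∂μ < ∞) :
    ∫⁻ y, ENNReal.ofReal (min 1 (‖y‖ ^ 2)) ∂radialMeasure k (gaussMix k μ) < ∞ := by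
  have := sFinite_restrict_Ioi hμ
  let W : Rk k → ℂ := fun y => ((min 1 (‖y‖ ^ 2) : ℝ) : ℂ)
  have h := integrable_gaussMix_mul (integrable_heatKernel_prod_of_le_min hμ (W := W) (C := 1)
    (by fun_prop) (fun x => by
      rw [Complex.norm_real, one_mul, Real.norm_of_nonneg (by positivity)]) zero_le_one)
  have h2 := h.re.lintegral_lt_top
  have hm : Measurable fun x : Rk k => ENNReal.ofReal (gaussMix k μ ‖x‖) :=
    (measurable_gaussMix.comp measurable_norm).ennreal_ofReal
  rw [radialMeasure, lintegral_withDensity_eq_lintegral_mul _ hm (by fun_prop)]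
  refine lt_of_eq_of_lt (lintegral_congr fun x => ?_) h2
  rw [Pi.mul_apply, ← ENNReal.ofReal_mul (gaussMix_nonneg k _), ← Complex.ofReal_mul]
  rfl

end

/-! ### Radial densities that are completely monotone in the squared norm -/

/-- At `s = 0` the Gaussian function is the constant `1`, which is not integrable. -/
lemma measure_singleton_zero_of_integrable {k : ℕ} (hk : 1 ≤ k) {ρ : Measure ℝ}
    (h : ∀ᵐ s ∂ρ, Integrable fun x : Rk k => Real.exp (-(‖x‖ ^ 2 * s))) : ρ {0} = 0 := by
  refine measure_mono_null (fun s hs => ?_) (ae_iff.1 h)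
  have : Nonempty (Fin k) := ⟨⟨0, hk⟩⟩
  have : NoncompactSpace (Rk k) := NormedSpace.noncompactSpace ℝ (Rk k)
  rw [mem_singleton_iff] at hs
  rw [hs]
  intro h'
  change Integrable (fun x : Rk k => Real.exp (-(‖x‖ ^ 2 * 0))) at h'
  simp only [mul_zero, neg_zero, Real.exp_zero] at h'
  rw [integrable_const_iff] at h'
  rcases h' with h' | h'
  · exact one_ne_zero h'
  · exact (h'.measure_univ_lt_top).ne (measure_univ_of_isAddLeftInvariant volume)

/-- By Bernstein's theorem, `g(|x|²)` is a mixture of the Gaussian functions `e^{-s|x|²}`, whose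
Fourier transforms `(π/s)^{k/2} e^{-|ξ|²/4s}` are completely monotone in `|ξ|²`. -/
lemma exists_isDiffCM_fourier {k : ℕ} (hk : 1 ≤ k) {g : ℝ → ℝ} (hg : IsDiffCM g)
    (hgc : ContinuousOn g (Ici 0)) (hi : Integrable fun x : Rk k => g (‖x‖ ^ 2)) :
    ∃ H : ℝ → ℝ, IsDiffCM H ∧ ∀ ξ : Rk k,
      ∫ x : Rk k, (g (‖x‖ ^ 2) : ℂ) * Complex.exp ((inner ℝ x ξ : ℝ) * Complex.I) =
        (H (‖ξ‖ ^ 2) : ℂ) := by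
  obtain ⟨ρ, hρ, hρ0, hρg⟩ := hg.exists_laplace hgc
  have hgx : ∀ x : Rk k, g (‖x‖ ^ 2) = ∫ s, Real.exp (-(‖x‖ ^ 2 * s)) ∂ρ := fun x =>
    hρg _ (by positivity)
  -- by Tonelli, since the `s`-integrals `g(|x|²)` are integrable in `x`
  have hprod : Integrable (fun p : Rk k × ℝ => Real.exp (-(‖p.1‖ ^ 2 * p.2)))
      (volume.prod ρ) := by
    rw [integrable_prod_iff (by fun_prop)]
    refine ⟨.of_forall fun x => integrable_exp_neg_mul hρ0 (sq_nonneg ‖x‖), hi.congr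
      (.of_forall fun x => ?_)⟩
    simp only [hgx, Real.norm_eq_abs, Real.abs_exp]
  have hsec := ((integrable_prod_iff' (by fun_prop)).1 hprod).1
  have hpos : ∀ᵐ s ∂ρ, 0 < s := by
    have h0 : ∀ᵐ s ∂ρ, s ≠ 0 := by
      simpa [ae_iff] using measure_singleton_zero_of_integrable hk hsec
    filter_upwards [h0, ae_nonneg_of_measure_Iio_eq_zero hρ0] with s h1 h2
    exact lt_of_le_of_ne h2 h1.symm
  set w : ℝ → ℝ := fun s => ∫ x : Rk k, Real.exp (-(‖x‖ ^ 2 * s))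
  have hw : Integrable w ρ := hprod.integral_prod_right
  refine ⟨fun u => ∫ s, w s * Real.exp (-(u * (1 / (4 * s)))) ∂ρ, isDiffCM_integral hw
    (.of_forall fun s => integral_nonneg fun x => (Real.exp_pos _).le) (by fun_prop)
    (hpos.mono fun s hs => by positivity), fun ξ => ?_⟩
  have hprod2 : Integrable (fun p : Rk k × ℝ => (Real.exp (-(‖p.1‖ ^ 2 * p.2)) : ℂ) *
      Complex.exp ((inner ℝ p.1 ξ : ℝ) * Complex.I)) (volume.prod ρ) := by
    refine (hprod.ofReal (𝕜 := ℂ)).mul_bdd (c := 1) (by fun_prop) (.of_forall fun p => ?_)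
    rw [Complex.norm_exp_ofReal_mul_I]
  calc _ = ∫ x : Rk k, ∫ s, (Real.exp (-(‖x‖ ^ 2 * s)) : ℂ) *
        Complex.exp ((inner ℝ x ξ : ℝ) * Complex.I) ∂ρ := by
        congr 1 with x
        rw [integral_mul_const, integral_complex_ofReal, hgx]
    _ = ∫ s, (∫ x : Rk k, (Real.exp (-(‖x‖ ^ 2 * s)) : ℂ) *
        Complex.exp ((inner ℝ x ξ : ℝ) * Complex.I)) ∂ρ := integral_integral_swap hprod2
    _ = ∫ s, ((w s * Real.exp (-(‖ξ‖ ^ 2 * (1 / (4 * s)))) : ℝ) : ℂ) ∂ρ := by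
        refine integral_congr_ae ?_
        filter_upwards [hpos] with s hs
        have h1 : w s = (Real.pi / s) ^ ((k : ℝ) / 2) := by
          have := GaussianFourier.integral_rexp_neg_mul_sq_norm (V := Rk k) hs
          rw [finrank_euclideanSpace_fin] at this
          rw [← this]
          refine integral_congr_ae (.of_forall fun x => ?_)
          ring_nf
        rw [h1, ← integral_exp_mul_cexp k hs ξ]
        simp only [mul_comm s]
    _ = _ := integral_complex_ofReal

/-- The profile `p` may be singular at `0`; `p(√(|x|² + ε))` is a regular approximation, increasing
to `p(|x|)` as `ε → 0`. -/
theorem isDiffCM_of_charFun_radialLaw {k : ℕ} (hk : 1 ≤ k) {p : ℝ → ℝ} (hp : IsCMProfile p)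
    {c : ℝ≥0∞} {t : ℝ≥0} [IsFiniteMeasure (radialLaw k c t p)] {G : ℝ → ℝ}
    (hG : ∀ ξ : Rk k, charFun (radialLaw k c t p) ξ = (G (‖ξ‖ ^ 2) : ℂ)) : IsDiffCM G := by
  set g : ℝ → ℝ := fun r => p (√r)
  have hg : IsCompletelyMonotone g := hp.2
  have hgc : ContinuousOn g (Ioi 0) := hg.1.continuousOn
  have hfin : radialMeasure k p univ < ∞ := lt_of_le_of_lt
    (Measure.le_add_left le_rfl univ) (measure_lt_top (radialLaw k c t p) univ)
  have hp_eq : ∀ x : Rk k, p ‖x‖ = g (‖x‖ ^ 2) := fun x => by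
    simp only [g]; rw [Real.sqrt_sq (norm_nonneg x)]
  have hne := ae_ne_zero hk
  have hmeas : AEMeasurable fun x : Rk k => p ‖x‖ := by
    classical
    refine ⟨fun x => (Ioi 0).piecewise g 0 (‖x‖ ^ 2), ?_, ?_⟩
    · exact (hgc.measurable_piecewise continuousOn_const measurableSet_Ioi).comp (by fun_prop)
    · filter_upwards [hne] with x hx
      rw [hp_eq, piecewise_eq_of_mem]
      exact mem_Ioi.2 (by positivity)
  have hint : Integrable fun x : Rk k => p ‖x‖ := by
    refine ⟨hmeas.aestronglyMeasurable, ?_⟩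
    rw [hasFiniteIntegral_iff_ofReal (.of_forall fun x => hp.1 _ (norm_nonneg x))]
    rwa [radialMeasure, withDensity_apply _ MeasurableSet.univ, Measure.restrict_univ] at hfin
  have hmono : ∀ ε, 0 < ε → ∀ r, 0 < r → g (r + ε) ≤ g r := fun ε hε r hr => by
    have := (hg.diff hε.le).2 0 r hr
    simpa using this
  have hreg : ∀ n : ℕ, IsDiffCM fun u => g (u + 1 / ((n : ℝ) + 1)) := fun n =>
    hg.isDiffCM_comp_add (by positivity)
  have hregc : ∀ n : ℕ, ContinuousOn (fun u => g (u + 1 / ((n : ℝ) + 1))) (Ici 0) := fun n =>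
    hgc.comp (by fun_prop) fun u hu => by
      have hu' : (0 : ℝ) ≤ u := hu
      exact mem_Ioi.2 (by positivity)
  have hle : ∀ n : ℕ, ∀ᵐ x : Rk k, ‖g (‖x‖ ^ 2 + 1 / ((n : ℝ) + 1))‖ ≤ p ‖x‖ := fun n => by
    filter_upwards [hne] with x hx
    have hx' : 0 < ‖x‖ ^ 2 := by positivity
    rw [Real.norm_of_nonneg ((hreg n).nonneg hx'.le), hp_eq]
    exact hmono _ (by positivity) _ hx'
  have hgm : ∀ n : ℕ, Continuous fun x : Rk k => g (‖x‖ ^ 2 + 1 / ((n : ℝ) + 1)) := fun n =>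
    hgc.comp_continuous (by fun_prop) fun x => mem_Ioi.2 (by positivity)
  choose H hH hHξ using fun n : ℕ => exists_isDiffCM_fourier hk (hreg n) (hregc n)
    (hint.mono' (hgm n).aestronglyMeasurable (hle n))
  set a : ℝ := (EReal.exp (-((c * t : ℝ≥0∞) : EReal))).toReal
  have hatom : EReal.exp (-((c * t : ℝ≥0∞) : EReal)) ≠ ∞ := by
    rw [Ne, EReal.exp_eq_top_iff, EReal.neg_eq_top_iff]
    exact EReal.coe_ennreal_ne_bot _
  have hchar : ∀ ξ : Rk k, (G (‖ξ‖ ^ 2) : ℂ) =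
      (a : ℂ) + ∫ x : Rk k, (p ‖x‖ : ℂ) * Complex.exp ((inner ℝ x ξ : ℝ) * Complex.I) := by
    intro ξ
    have : IsFiniteMeasure (radialMeasure k p) := ⟨hfin⟩
    have hm : Measurable fun x : Rk k => Complex.exp ((inner ℝ x ξ : ℝ) * Complex.I) := by fun_prop
    rw [← hG, charFun_apply, radialLaw, integral_add_measure, integral_smul_measure, integral_dirac,
      radialMeasure, integral_withDensity_eq_integral_toReal_smul₀ hmeas.ennreal_ofReal
        (.of_forall fun _ => ENNReal.ofReal_lt_top)]
    · congr 1
      · simp [a]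
      · congr 1 with x
        rw [ENNReal.toReal_ofReal (hp.1 _ (norm_nonneg x)), Complex.real_smul]
    · exact (integrable_dirac (by simp)).smul_measure hatom
    · refine (integrable_const (1 : ℝ)).mono' hm.aestronglyMeasurable (.of_forall fun x => ?_)
      rw [Complex.norm_exp_ofReal_mul_I]
  refine fun m => DiffMonotone.of_tendsto (l := atTop) (F := fun (n : ℕ) u => a + H n u)
    (.of_forall fun n => (DiffMonotone.const ENNReal.toReal_nonneg m).add (hH n m)) fun u hu => ?_
  obtain ⟨ξ, hξ⟩ : ∃ ξ : Rk k, ‖ξ‖ ^ 2 = u :=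
    ⟨EuclideanSpace.single ⟨0, hk⟩ (√u), by simp [Real.sq_sqrt hu]⟩
  rw [← hξ, ← tendsto_ofReal_iff]
  rw [hchar]
  simp only [Complex.ofReal_add, ← hHξ]
  refine tendsto_const_nhds.add (tendsto_integral_of_dominated_convergence (fun x => p ‖x‖)
    (fun n => ?_) hint (fun n => ?_) ?_)
  · exact ((Complex.continuous_ofReal.comp (hgm n)).mul (by fun_prop)).aestronglyMeasurable
  · filter_upwards [hle n] with x hx
    rwa [norm_mul, Complex.norm_exp_ofReal_mul_I, mul_one, Complex.norm_real]
  · filter_upwards [hne] with x hx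
    have hx' : 0 < ‖x‖ ^ 2 := by positivity
    refine Tendsto.mul_const _ ((Complex.continuous_ofReal.tendsto _).comp ?_)
    rw [hp_eq]
    refine (hgc.continuousAt (Ioi_mem_nhds hx')).tendsto.comp ?_
    simpa using tendsto_one_div_add_atTop_nhds_zero_nat.const_add (‖x‖ ^ 2)

lemma tendsto_mul_one_sub_cexp (z : ℂ) :
    Tendsto (fun m : ℕ => (m : ℂ) * (1 - Complex.exp (-(z / m)))) atTop (𝓝 z) := by
  have hd : HasDerivAt (fun t : ℝ => -Complex.exp (-(z * t))) z 0 := by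
    simpa using (((hasDerivAt_id' (0 : ℝ)).ofReal_comp.const_mul z).fun_neg.cexp).fun_neg
  refine (hd.tendsto_slope_zero_right.comp
    (tendsto_inv_atTop_nhdsGT_zero.comp tendsto_natCast_atTop_atTop)).congr fun m => ?_
  simp only [Function.comp_apply, inv_inv, Complex.real_smul, Complex.ofReal_zero, mul_zero,
    neg_zero, Complex.exp_zero, zero_add, div_eq_mul_inv, Complex.ofReal_inv,
    Complex.ofReal_natCast]
  ring

lemma HasCharExponent.charFun_radialSymbol {Ω : Type*} [MeasurableSpace Ω] {k : ℕ} {P : Measure Ω}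
    {X : ℝ≥0 → Ω → Rk k} {f : ℝ → ℝ} (h : HasCharExponent P X (radialSymbol f k)) (t : ℝ≥0)
    (ξ : Rk k) : charFun (P.map (X t)) ξ = (Real.exp (-(t * f (‖ξ‖ ^ 2))) : ℂ) := by
  rw [h t ξ, radialSymbol]
  push_cast
  rfl

/-- All `e^{-tf}`, `t > 0`, are completely monotone, hence so are the increments of
`f = lim (1 - e^{-tf}) / t`. -/
theorem isDiffBernstein_of_law {Ω : Type*} [MeasurableSpace Ω] {k : ℕ} (hk : 1 ≤ k) {P : Measure Ω}
    {X : ℝ≥0 → Ω → Rk k} {f : ℝ → ℝ} (hX : IsLevyProcess P X)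
    (hψ : HasCharExponent P X (radialSymbol f k)) {c : ℝ≥0∞} {p : ℝ≥0 → ℝ → ℝ}
    (hp : ∀ t : ℝ≥0, 0 < t → IsCMProfile (p t) ∧ P.map (X t) = radialLaw k c t (p t)) :
    IsDiffBernstein f := by
  have := hX.isProbabilityMeasure
  have hprob : ∀ t, IsProbabilityMeasure (P.map (X t)) := fun t =>
    Measure.isProbabilityMeasure_map (hX.measurable t).aemeasurable
  have hCM : ∀ t : ℝ≥0, 0 < t → IsDiffCM fun u => Real.exp (-(t * f u)) := fun t ht => by
    have : IsFiniteMeasure (radialLaw k c t (p t)) := (hp t ht).2 ▸ inferInstance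
    refine isDiffCM_of_charFun_radialLaw hk (hp t ht).1 (c := c) (t := t) fun ξ => ?_
    rw [← (hp t ht).2, hψ.charFun_radialSymbol]
  have h1 : ∀ ξ : Rk k, charFun (P.map (X 1)) ξ = (Real.exp (-f (‖ξ‖ ^ 2)) : ℂ) := fun ξ => by
    rw [hψ.charFun_radialSymbol, NNReal.coe_one, one_mul]
  refine ⟨?_, ?_, fun a ha n => ?_⟩
  · have h2 := h1 0
    rw [charFun_zero, norm_zero, probReal_univ] at h2
    simpa using (show Real.exp (-f (0 ^ 2)) = 1 by exact_mod_cast h2.symm)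
  · let e : Rk k := EuclideanSpace.single ⟨0, hk⟩ 1
    have h2 : Continuous fun u : ℝ => -Real.log (charFun (P.map (X 1)) (√u • e)).re :=
      (Continuous.log (by
        exact Complex.continuous_re.comp (continuous_charFun.comp
          (Real.continuous_sqrt.smul continuous_const))) fun u => by
            rw [h1, Complex.ofReal_re]; exact (Real.exp_pos _).ne').neg
    refine h2.continuousOn.congr fun u hu => ?_
    simp only [h1, Complex.ofReal_re, Real.log_exp, neg_neg]
    simp [e, norm_smul, Real.sq_sqrt (show 0 ≤ u from hu)]
  · refine DiffMonotone.of_tendsto (l := atTop) (F := fun (m : ℕ) u => (m : ℝ) *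
      (Real.exp (-(((m : ℝ≥0)⁻¹ : ℝ≥0) * f u)) - Real.exp (-(((m : ℝ≥0)⁻¹ : ℝ≥0) * f (u + a)))))
      ?_ fun u hu => ?_
    · filter_upwards [eventually_gt_atTop 0] with m hm
      exact (((hCM _ (by positivity)).diff ha) n).const_mul (by positivity)
    · have hlim : ∀ x : ℝ, Tendsto (fun m : ℕ => (m : ℝ) * (1 - Real.exp (-(x / m)))) atTop (𝓝 x) :=
        fun x => by
          rw [← tendsto_ofReal_iff]
          refine (tendsto_mul_one_sub_cexp x).congr fun m => by push_cast; rfl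
      refine ((hlim (f (u + a))).sub (hlim (f u))).congr fun m => ?_
      push_cast
      rw [div_eq_inv_mul, div_eq_inv_mul]
      ring

/-! ### Uniqueness of the Lévy measure -/

section
variable {k : ℕ} {ν : Measure (Rk k)}

lemma integrable_levyIntegrand (hν : ∫⁻ y, ENNReal.ofReal (min 1 (‖y‖ ^ 2)) ∂ν < ∞) (ξ : Rk k) :
    Integrable (levyIntegrand ξ) ν := by
  have h : Integrable (fun y : Rk k => min 1 (‖y‖ ^ 2)) ν := by
    refine ⟨by fun_prop, ?_⟩
    rwa [hasFiniteIntegral_iff_ofReal (.of_forall fun y => by positivity)]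
  exact (h.const_mul _).mono' (by fun_prop) (.of_forall (norm_levyIntegrand_le ξ))

/-- The weight `2 (1 - cos(w·y))` that a second difference in direction `w` introduces. -/
noncomputable def cosWeight (w y : Rk k) : ℝ≥0∞ := ENNReal.ofReal (2 * (1 - Real.cos (inner ℝ y w)))

@[fun_prop]
lemma measurable_cosWeight (w : Rk k) : Measurable (cosWeight w) := by
  unfold cosWeight; fun_prop

lemma levyIntegrand_second_diff (ξ w y : Rk k) :
    levyIntegrand (ξ + w) y + levyIntegrand (ξ - w) y - 2 * levyIntegrand ξ y =
      ((cosWeight w y).toReal : ℂ) * Complex.exp ((inner ℝ y ξ : ℝ) * Complex.I) := by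
  have hcos : (0 : ℝ) ≤ 2 * (1 - Real.cos (inner ℝ y w)) := by
    linarith [Real.cos_le_one (inner ℝ y w)]
  -- the compensators are linear in `ξ` and cancel
  have h1 : (Metric.ball (0 : Rk k) 1).indicator
      (fun z => Complex.I * (inner ℝ z (ξ + w) : ℝ)) y + (Metric.ball (0 : Rk k) 1).indicator
      (fun z => Complex.I * (inner ℝ z (ξ - w) : ℝ)) y = 2 * (Metric.ball (0 : Rk k) 1).indicator
      (fun z => Complex.I * (inner ℝ z ξ : ℝ)) y := by
    by_cases hy : y ∈ Metric.ball (0 : Rk k) 1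
    · simp only [indicator_of_mem hy, inner_add_right, inner_sub_right]
      push_cast; ring
    · simp only [indicator_of_notMem hy]; ring
  have h2 : Complex.exp (Complex.I * (inner ℝ y (ξ + w) : ℝ)) +
      Complex.exp (Complex.I * (inner ℝ y (ξ - w) : ℝ)) =
      2 * Complex.cos (inner ℝ y w : ℝ) * Complex.exp ((inner ℝ y ξ : ℝ) * Complex.I) := by
    rw [Complex.two_cos, inner_add_right, inner_sub_right, add_mul, ← Complex.exp_add,
      ← Complex.exp_add]
    congr 2 <;> (push_cast; ring)
  rw [cosWeight, ENNReal.toReal_ofReal hcos]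
  simp only [levyIntegrand]
  rw [mul_comm Complex.I (inner ℝ y ξ : ℝ)]
  push_cast
  linear_combination h1 - h2

/-- The second difference of the exponent in direction `w` is the characteristic function of the
finite measure `2 (1 - cos(w·y)) ν(dy) + (w·Qw) δ₀`. -/
lemma levyKhintchineExponent_second_diff {b : Rk k} {Q : Matrix (Fin k) (Fin k) ℝ}
    (hQ : Q.PosSemidef) (hν : ∫⁻ y, ENNReal.ofReal (min 1 (‖y‖ ^ 2)) ∂ν < ∞) (w : Rk k) :
    IsFiniteMeasure (ν.withDensity (cosWeight w) +
      ENNReal.ofReal (WithLp.ofLp w ⬝ᵥ Q.mulVec (WithLp.ofLp w)) • Measure.dirac 0) ∧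
    ∀ ξ, charFun (ν.withDensity (cosWeight w) +
      ENNReal.ofReal (WithLp.ofLp w ⬝ᵥ Q.mulVec (WithLp.ofLp w)) • Measure.dirac 0) ξ =
      levyKhintchineExponent b Q ν (ξ + w) + levyKhintchineExponent b Q ν (ξ - w) -
        2 * levyKhintchineExponent b Q ν ξ := by
  have hint : ∀ ξ, Integrable (fun y => levyIntegrand (ξ + w) y + levyIntegrand (ξ - w) y -
      2 * levyIntegrand ξ y) ν := fun ξ =>
    ((integrable_levyIntegrand hν _).add (integrable_levyIntegrand hν _)).sub
      ((integrable_levyIntegrand hν _).const_mul 2)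
  simp only [levyIntegrand_second_diff] at hint
  have hfin : IsFiniteMeasure (ν.withDensity (cosWeight w)) := by
    refine isFiniteMeasure_withDensity ?_
    have h0 := (hint 0).re.lintegral_lt_top
    simp only [inner_zero_right, Complex.ofReal_zero, zero_mul, Complex.exp_zero, mul_one,
      RCLike.re_to_complex, Complex.ofReal_re] at h0
    refine ne_of_lt (lt_of_eq_of_lt (lintegral_congr fun y => ?_) h0)
    rw [ENNReal.ofReal_toReal]
    exact ENNReal.ofReal_ne_top
  have hq : 0 ≤ WithLp.ofLp w ⬝ᵥ Q.mulVec (WithLp.ofLp w) := by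
    simpa using hQ.dotProduct_mulVec_nonneg (WithLp.ofLp w)
  have := Measure.smul_finite (Measure.dirac (0 : Rk k))
    (ENNReal.ofReal_ne_top (r := WithLp.ofLp w ⬝ᵥ Q.mulVec (WithLp.ofLp w)))
  refine ⟨inferInstance, fun ξ => ?_⟩
  have hm : Measurable fun x : Rk k => Complex.exp ((inner ℝ x ξ : ℝ) * Complex.I) := by fun_prop
  rw [charFun_apply, integral_add_measure, integral_smul_measure, integral_dirac,
    ENNReal.toReal_ofReal hq, integral_withDensity_eq_integral_toReal_smul (measurable_cosWeight w)
      (.of_forall fun _ => ENNReal.ofReal_lt_top)]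
  · have h1 : ∫ y, (cosWeight w y).toReal • Complex.exp ((inner ℝ y ξ : ℝ) * Complex.I) ∂ν =
        (∫ y, levyIntegrand (ξ + w) y ∂ν) + (∫ y, levyIntegrand (ξ - w) y ∂ν) -
          2 * ∫ y, levyIntegrand ξ y ∂ν := by
      rw [← integral_const_mul, ← integral_add (integrable_levyIntegrand hν _)
        (integrable_levyIntegrand hν _), ← integral_sub
          (by exact (integrable_levyIntegrand hν _).add (integrable_levyIntegrand hν _))
          ((integrable_levyIntegrand hν _).const_mul 2)]
      congr 1 with y
      rw [levyIntegrand_second_diff, Complex.real_smul]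
    have h2 : WithLp.ofLp (ξ + w) ⬝ᵥ Q.mulVec (WithLp.ofLp (ξ + w)) +
        WithLp.ofLp (ξ - w) ⬝ᵥ Q.mulVec (WithLp.ofLp (ξ - w)) =
        2 * (WithLp.ofLp ξ ⬝ᵥ Q.mulVec (WithLp.ofLp ξ)) +
        2 * (WithLp.ofLp w ⬝ᵥ Q.mulVec (WithLp.ofLp w)) := by
      simp only [WithLp.ofLp_add, WithLp.ofLp_sub, Matrix.mulVec_add, Matrix.mulVec_sub,
        dotProduct_add, dotProduct_sub, add_dotProduct, sub_dotProduct]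
      ring
    have h2' := congrArg (fun r : ℝ => (r : ℂ)) h2
    push_cast at h2'
    rw [h1]
    have h3 : ∀ η, levyKhintchineExponent b Q ν η = -Complex.I * (inner ℝ b η : ℝ) +
        (1 / 2 : ℂ) * ((WithLp.ofLp η ⬝ᵥ Q.mulVec (WithLp.ofLp η) : ℝ) : ℂ) +
          ∫ y, levyIntegrand η y ∂ν := fun _ => rfl
    simp only [h3, inner_add_right, inner_sub_right,
      inner_zero_left, Complex.ofReal_zero, zero_mul, Complex.exp_zero, Complex.real_smul, mul_one]
    push_cast
    linear_combination -(1 / 2 : ℂ) * h2'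
  · refine (integrable_const (1 : ℝ)).mono' hm.aestronglyMeasurable (.of_forall fun x => ?_)
    rw [Complex.norm_exp_ofReal_mul_I]
  · exact (integrable_dirac (by simp)).smul_measure ENNReal.ofReal_ne_top

/-- Where its weight does not vanish, `ν` is recovered from the measure of the second difference. -/
lemma restrict_eq_withDensity_cosWeight (w : Rk k) (q : ℝ≥0∞) :
    ν.restrict {y | cosWeight w y ≠ 0} =
      ((ν.withDensity (cosWeight w) + q • Measure.dirac 0).restrict
        {y | cosWeight w y ≠ 0}).withDensity (cosWeight w)⁻¹ := by
  have hA : MeasurableSet {y : Rk k | cosWeight w y ≠ 0} :=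
    (measurable_cosWeight w (measurableSet_singleton 0)).compl
  have h0 : (0 : Rk k) ∉ {y : Rk k | cosWeight w y ≠ 0} := by simp [cosWeight]
  classical
  rw [Measure.restrict_add, Measure.restrict_smul, restrict_dirac' hA, if_neg h0, smul_zero,
    add_zero, restrict_withDensity hA]
  exact (withDensity_inv_same (measurable_cosWeight w) (ae_restrict_mem hA)
    (.of_forall fun _ => ENNReal.ofReal_ne_top)).symm

lemma iUnion_cosWeight_ne_zero :
    ⋃ p : Fin k × ℕ, {y : Rk k |
      cosWeight (EuclideanSpace.single p.1 (1 / ((p.2 : ℝ) + 1))) y ≠ 0} = {0}ᶜ := by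
  ext y
  simp only [mem_iUnion, mem_compl_iff, mem_singleton_iff]
  constructor
  · rintro ⟨p, hp⟩ rfl
    simp [cosWeight] at hp
  · intro hy
    obtain ⟨j, hj⟩ : ∃ j, y j ≠ 0 := by
      by_contra! h
      exact hy (by ext j; simpa using h j)
    -- `0 < |y j / (n + 1)| < 2π`, so its cosine differs from `1`
    obtain ⟨n, hn⟩ := exists_nat_gt |y j|
    refine ⟨(j, n), ?_⟩
    have hn1 : (0 : ℝ) < (n : ℝ) + 1 := by positivity
    have hx : |y j * (1 / ((n : ℝ) + 1))| < 2 * Real.pi := by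
      rw [abs_mul, abs_of_pos (by positivity : 0 < 1 / ((n : ℝ) + 1)), mul_one_div,
        div_lt_iff₀ hn1]
      nlinarith [Real.pi_gt_three, abs_nonneg (y j)]
    have hcos : Real.cos (y j * (1 / ((n : ℝ) + 1))) ≠ 1 := by
      rw [Ne, Real.cos_eq_one_iff_of_lt_of_lt (abs_lt.1 hx).1 (abs_lt.1 hx).2]
      positivity
    have : Real.cos (y j * (1 / ((n : ℝ) + 1))) < 1 := lt_of_le_of_ne (Real.cos_le_one _) hcos
    simp only [cosWeight, EuclideanSpace.inner_single_right, mem_ofPred_eq]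
    simp only [conj_trivial, ne_eq, ENNReal.ofReal_eq_zero, not_le]
    rw [mul_comm (1 / _)]
    linarith

/-- The exponent determines the Lévy measure, as its second differences determine it on each of the
sets `{y | cos(w·y) ≠ 1}`, countably many of which cover `ℝᵏ ∖ {0}`. -/
theorem levyMeasure_unique {ν' : Measure (Rk k)} {b b' : Rk k} {Q Q' : Matrix (Fin k) (Fin k) ℝ}
    (hQ : Q.PosSemidef) (hQ' : Q'.PosSemidef) (h0 : ν {0} = 0) (h0' : ν' {0} = 0)
    (hν : ∫⁻ y, ENNReal.ofReal (min 1 (‖y‖ ^ 2)) ∂ν < ∞)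
    (hν' : ∫⁻ y, ENNReal.ofReal (min 1 (‖y‖ ^ 2)) ∂ν' < ∞)
    (h : ∀ ξ, levyKhintchineExponent b Q ν ξ = levyKhintchineExponent b' Q' ν' ξ) : ν = ν' := by
  have hr : ∀ ρ : Measure (Rk k), ρ {0} = 0 → ρ.restrict {0}ᶜ = ρ := fun ρ hρ =>
    Measure.restrict_eq_self_of_ae_mem (by simpa [ae_iff] using hρ)
  rw [← hr ν h0, ← hr ν' h0', ← iUnion_cosWeight_ne_zero, Measure.restrict_iUnion_congr]
  intro p
  set w : Rk k := EuclideanSpace.single p.1 (1 / ((p.2 : ℝ) + 1))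
  obtain ⟨i1, e1⟩ := levyKhintchineExponent_second_diff (b := b) hQ hν w
  obtain ⟨i2, e2⟩ := levyKhintchineExponent_second_diff (b := b') hQ' hν' w
  have : ν.withDensity (cosWeight w) +
      ENNReal.ofReal (WithLp.ofLp w ⬝ᵥ Q.mulVec (WithLp.ofLp w)) • Measure.dirac 0 =
      ν'.withDensity (cosWeight w) +
      ENNReal.ofReal (WithLp.ofLp w ⬝ᵥ Q'.mulVec (WithLp.ofLp w)) • Measure.dirac 0 :=
    Measure.ext_of_charFun (funext fun ξ => by rw [e1, e2, h, h, h])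
  rw [restrict_eq_withDensity_cosWeight w, this, ← restrict_eq_withDensity_cosWeight w]

end

/-- The exponent is recovered from `e^{-tψ}` for `t = 1/m` as the limit of `m (1 - e^{-ψ/m})`. -/
lemma HasCharExponent.unique {Ω : Type*} [MeasurableSpace Ω] {k : ℕ} {P : Measure Ω}
    {X : ℝ≥0 → Ω → Rk k} {ψ ψ' : Rk k → ℂ} (h : HasCharExponent P X ψ)
    (h' : HasCharExponent P X ψ') (ξ : Rk k) : ψ ξ = ψ' ξ := by
  refine tendsto_nhds_unique (tendsto_mul_one_sub_cexp (ψ ξ))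
    ((tendsto_mul_one_sub_cexp (ψ' ξ)).congr fun m => ?_)
  have e := (h ((m : ℝ≥0)⁻¹) ξ).symm.trans (h' ((m : ℝ≥0)⁻¹) ξ)
  push_cast at e
  rw [div_eq_inv_mul, div_eq_inv_mul, e]

/-! ### The atom at the origin -/

/-- The mass at `0` is the limit of `∫ e^{-us} η(ds) = e^{-tf(u)}` as `u → ∞`, so the rate `c` is
`sup f`, which may be infinite. -/
lemma measure_singleton_zero_eq_exp {f : ℝ → ℝ} (hf : MonotoneOn f (Ici 0))
    (hf0 : ∀ u, 0 ≤ u → 0 ≤ f u) {t : ℝ≥0}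
    {η : Measure ℝ} [IsFiniteMeasure η] (hη : η (Iio 0) = 0)
    (h : ∀ u, 0 ≤ u → ∫ s, Real.exp (-(u * s)) ∂η = Real.exp (-(t * f u))) :
    EReal.exp (-(((⨆ n : ℕ, ENNReal.ofReal (f n)) * t : ℝ≥0∞) : EReal)) = η {0} := by
  have hmono : Monotone fun n : ℕ => ENNReal.ofReal (f n) := fun m n hmn =>
    ENNReal.ofReal_le_ofReal (hf (mem_Ici.2 (by positivity)) (mem_Ici.2 (by positivity))
      (by exact_mod_cast hmn))
  have h1 : Tendsto (fun n : ℕ => EReal.exp (-((ENNReal.ofReal (f n) * t : ℝ≥0∞) : EReal))) atTop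
      (𝓝 (EReal.exp (-(((⨆ n : ℕ, ENNReal.ofReal (f n)) * t : ℝ≥0∞) : EReal)))) :=
    (ENNReal.continuous_exp.tendsto _).comp ((continuous_neg.tendsto _).comp
      ((continuous_coe_ennreal_ereal.tendsto _).comp (ENNReal.Tendsto.mul_const
        (tendsto_atTop_iSup hmono) (Or.inr ENNReal.coe_ne_top))))
  have h2 : Tendsto (fun n : ℕ => ∫ s, Real.exp (-(n * s)) ∂η) atTop (𝓝 (η.real {0})) := by
    have : η.real {0} = ∫ s, ({0} : Set ℝ).indicator (fun _ => (1 : ℝ)) s ∂η := by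
      rw [integral_indicator_const _ (measurableSet_singleton 0)]; simp
    rw [this]
    refine tendsto_integral_of_dominated_convergence (fun _ => 1) (fun n => by fun_prop)
      (integrable_const 1) (fun n => ?_) ?_
    · filter_upwards [ae_nonneg_of_measure_Iio_eq_zero hη] with s hs
      rw [Real.norm_of_nonneg (Real.exp_pos _).le, Real.exp_le_one_iff]
      have : 0 ≤ (n : ℝ) * s := by positivity
      linarith
    · filter_upwards [ae_nonneg_of_measure_Iio_eq_zero hη] with s hs
      rcases hs.eq_or_lt with rfl | hs
      · simp
      · rw [indicator_of_notMem (by simpa using hs.ne')]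
        exact Real.tendsto_exp_neg_atTop_nhds_zero.comp
          (tendsto_natCast_atTop_atTop.atTop_mul_const hs)
  have h3 := (ENNReal.continuous_ofReal.tendsto _).comp h2
  rw [ofReal_measureReal] at h3
  refine tendsto_nhds_unique h1 (h3.congr fun n => ?_)
  have hn := hf0 n (by positivity)
  have e : ENNReal.ofReal (f n) * t = ENNReal.ofReal (t * f n) := by
    rw [mul_comm, ENNReal.ofReal_mul t.coe_nonneg, ENNReal.ofReal_coe_nnreal]
  rw [Function.comp_apply, h _ (by positivity), e, EReal.coe_ennreal_ofReal,
    max_eq_left (by positivity), ← EReal.coe_neg, EReal.exp_coe]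

/-! ### Transition densities and Lévy densities -/

/-- The `k`-dimensional process with exponent `f(|ξ|²)` has the law of a Brownian motion at the
random time with law `η`. -/
lemma map_eq_radialLaw {Ω : Type*} [MeasurableSpace Ω] {k : ℕ} {P : Measure Ω}
    {X : ℝ≥0 → Ω → Rk k} {f : ℝ → ℝ} (hX : IsLevyProcess P X)
    (hψ : HasCharExponent P X (radialSymbol f k)) {t : ℝ≥0} {η : Measure ℝ} [IsFiniteMeasure η]
    (hη : η (Iio 0) = 0)
    (hηf : ∀ u, 0 ≤ u → ∫ s, Real.exp (-(u * s)) ∂η = Real.exp (-(t * f u))) {c : ℝ≥0∞}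
    (hc : EReal.exp (-((c * t : ℝ≥0∞) : EReal)) = η {0}) :
    P.map (X t) = radialLaw k c t (gaussMix k η) := by
  have := hX.isProbabilityMeasure
  have : IsFiniteMeasure (radialMeasure k (gaussMix k η)) := isFiniteMeasure_radialMeasure_gaussMix
  have : IsFiniteMeasure (radialLaw k c t (gaussMix k η)) := by
    rw [radialLaw, hc]
    have := Measure.smul_finite (Measure.dirac (0 : Rk k)) (measure_ne_top η {0})
    infer_instance
  refine Measure.ext_of_charFun (funext fun ξ => ?_)
  rw [hψ.charFun_radialSymbol, charFun_radialLaw_gaussMix hη hc, hηf _ (by positivity)]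

/-- The triplet `(0, 2α, gaussMix k μ (|x|) dx)` has the exponent `f(|ξ|²)`, and no other Lévy
measure has it. -/
lemma isLevyMeasureOf_iff {Ω : Type*} [MeasurableSpace Ω] {k : ℕ} (hk : 1 ≤ k) {P : Measure Ω}
    {X : ℝ≥0 → Ω → Rk k} {f : ℝ → ℝ} (hψ : HasCharExponent P X (radialSymbol f k)) {α : ℝ}
    {μ : Measure ℝ} (hα : 0 ≤ α) (hμ : ∫⁻ y in Ioi 0, ENNReal.ofReal (min 1 y) ∂μ < ∞)
    (hf : ∀ u, 0 ≤ u → f u = α * u + ∫ y in Ioi 0, (1 - Real.exp (-(u * y))) ∂μ)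
    (ν : Measure (Rk k)) :
    IsLevyMeasureOf ν P X ↔ ν = radialMeasure k (gaussMix k μ) := by
  have hzero : radialMeasure k (gaussMix k μ) {0} = 0 := by
    have : Nonempty (Fin k) := ⟨⟨0, hk⟩⟩
    exact withDensity_absolutelyContinuous _ _ (measure_singleton 0)
  have hQ : ((2 * α) • (1 : Matrix (Fin k) (Fin k) ℝ)).PosSemidef :=
    Matrix.PosSemidef.one.smul (by positivity)
  have hexp : ∀ ξ, levyKhintchineExponent 0 ((2 * α) • 1) (radialMeasure k (gaussMix k μ)) ξ =
      radialSymbol f k ξ := fun ξ => by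
    rw [levyKhintchineExponent_gaussMix hμ, radialSymbol, hf _ (by positivity)]
  constructor
  · rintro ⟨b, Q, h⟩
    exact levyMeasure_unique h.posSemidef hQ h.zero hzero h.integrable
      (lintegral_min_one_radialMeasure hμ)
      fun ξ => (h.exponent.unique hψ ξ).trans (hexp ξ).symm
  · rintro rfl
    exact ⟨0, (2 * α) • 1, hQ, hzero, lintegral_min_one_radialMeasure hμ,
      fun t ξ => by rw [hexp]; exact hψ t ξ⟩

lemma gaussMix_recursion {ρ : Measure ℝ} (hρ : ∫⁻ y in Ioi 0, ENNReal.ofReal (min 1 y) ∂ρ < ∞)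
    {k : ℕ} (hk : 3 ≤ k) {r : ℝ} (hr : 0 < r) :
    DifferentiableAt ℝ (gaussMix (k - 2) ρ) r ∧
      gaussMix k ρ r = -(1 / (2 * Real.pi * r)) * deriv (gaussMix (k - 2) ρ) r := by
  have h := hasDerivAt_gaussMix (k - 2) hρ hr
  rw [Nat.sub_add_cancel (by omega : 2 ≤ k)] at h
  refine ⟨h.differentiableAt, ?_⟩
  rw [h.deriv]
  field_simp

theorem mainTheorem3 (f : ℝ → ℝ) (hf : ∀ u, 0 ≤ u → 0 ≤ f u)
    -- one of the equivalent conditions holds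
    (h : (∀ k : ℕ, 1 ≤ k → IsContinuousNegativeDefinite (radialSymbol f k)) ∨
      (∀ n : ℕ, IsContinuousNegativeDefinite (radialSymbol f (1 + 2 * n))) ∨
      IsBernstein f ∨
      (∃ k : ℕ, 1 ≤ k ∧ ∃ (Ω : Type v) (_ : MeasurableSpace Ω) (P : Measure Ω)
        (X : ℝ≥0 → Ω → Rk k), IsLevyProcess P X ∧ HasCharExponent P X (radialSymbol f k) ∧
        ∃ (c : ℝ≥0∞) (p : ℝ≥0 → ℝ → ℝ), ∀ t : ℝ≥0, 0 < t →
          IsCMProfile (p t) ∧ P.map (X t) = radialLaw k c t (p t))) :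
    ∃ (c : ℝ≥0∞) (p : ℕ → ℝ≥0 → ℝ → ℝ) (m : ℕ → ℝ → ℝ),
      -- `p k t` and `m k` are radial profiles that are completely monotone in `|x|²`
      (∀ k : ℕ, 1 ≤ k → (∀ t : ℝ≥0, 0 < t → IsCMProfile (p k t)) ∧ IsCMProfile (m k)) ∧
      -- they are the transition density and the density of the Lévy measure of the
      -- `k`-dimensional Lévy process with characteristic exponent `f(|ξ|²)`
      (∀ k : ℕ, 1 ≤ k → ∀ (Ω : Type u) (_ : MeasurableSpace Ω) (P : Measure Ω)
        (X : ℝ≥0 → Ω → Rk k), IsLevyProcess P X → HasCharExponent P X (radialSymbol f k) →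
          (∀ t : ℝ≥0, 0 < t → P.map (X t) = radialLaw k c t (p k t)) ∧
          (∀ ν : Measure (Rk k), IsLevyMeasureOf ν P X ↔ ν = radialMeasure k (m k))) ∧
      -- the recursion for the transition densities
      (∀ k : ℕ, 3 ≤ k → ∀ (t : ℝ≥0) (r : ℝ), 0 < t → 0 < r →
        DifferentiableAt ℝ (p (k - 2) t) r ∧
          p k t r = -(1 / (2 * Real.pi * r)) * deriv (p (k - 2) t) r) ∧
      -- the recursion for the densities of the Lévy measures
      (∀ k : ℕ, 3 ≤ k → ∀ r : ℝ, 0 < r →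
        DifferentiableAt ℝ (m (k - 2)) r ∧
          m k r = -(1 / (2 * Real.pi * r)) * deriv (m (k - 2)) r) := by
  have hB : IsDiffBernstein f := by
    rcases h with h | h | h | ⟨k, hk, Ω, _, P, X, hX, hψ, c, p, hp⟩
    · exact isDiffBernstein_of_isContinuousNegativeDefinite hf fun n => h _ (by omega)
    · exact isDiffBernstein_of_isContinuousNegativeDefinite hf h
    · exact h.isDiffBernstein
    · exact isDiffBernstein_of_law hk hX hψ hp
  obtain ⟨α, μ, hα, hμ, hfμ⟩ := hB.isBernstein
  choose η hη hη0 hηf using fun t : ℝ≥0 => hB.exists_subordinator t.coe_nonneg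
  have hηmin := fun t => lintegral_min_one_lt_top (η t)
  refine ⟨⨆ n : ℕ, ENNReal.ofReal (f n), fun k t => gaussMix k (η t), fun k => gaussMix k μ,
    fun k _ => ⟨fun t _ => isCMProfile_gaussMix k (hηmin t), isCMProfile_gaussMix k hμ⟩,
    fun k hk Ω _ P X hX hψ => ⟨fun t _ => ?_, isLevyMeasureOf_iff hk hψ hα hμ hfμ⟩,
    fun k hk t r _ hr => gaussMix_recursion (hηmin t) hk hr,
    fun k hk r hr => gaussMix_recursion hμ hk hr⟩
  exact map_eq_radialLaw hX hψ (hη0 t) (hηf t)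
    (measure_singleton_zero_eq_exp hB.monotoneOn hf (hη0 t) (hηf t))
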